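/- Let $\theta>0$ and $\xi>0$. On $\mathbb R^2$ let $\Theta=\theta\begin{pmatrix}0&1\\-1&0\end{pmatrix}$, write $x\Theta^{-1}y=x^\mu\Theta^{-1}_{\mu\nu}y^\nu$, and put $\tilde x_\mu=2\Theta^{-1}_{\mu\nu}x^\nu$. For Schwartz functions $a,f\in\mathcal S(\mathbb R^2)$ let $$(a\star f)(x)=\frac1{(\pi\theta)^2}\int d^2y\,d^2z\;a(x+y)f(x+z)e^{-2i\,y\Theta^{-1}z}$$ be the Moyal product, and let $L(a)$ be the bounded operator on $L^2(\mathbb R^2)$ with $L(a)f=a\star f$ for all $f\in\mathcal S(\mathbb R^2)$. Let $H_L$ be the Landau Hamiltonian on $L^2(\mathbb R^2)$, that is, the closure of the operator $-\partial^2+\xi^2\tilde x^2-2i\xi\,\tilde x_\mu\partial_\mu$ with domain $\mathcal S(\mathbb R^2)$. Then the operators $L(a)$ exist, $H_L+\mu^2$ has an everywhere defined bounded inverse for every $\mu\in\mathbb R$, and the following hold. i) For all $a\in\mathcal S(\mathbb R^2)$ and $\mu\in\mathbb R$, the operator $L(a)(H_L+\mu^2)^{-1}$ has the integral kernel $$K(x,y)=\frac{e^{2i\,x\Theta^{-1}y}}{(\pi\theta)^2}\int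 d^2u\,d^2v\;a(u)\,\Phi(v)\,e^{2i\,x\Theta^{-1}(v-u)}\,e^{2i\,y\Theta^{-1}(u+\xi v)}\,e^{-2i\,u\Theta^{-1}v},$$ $$\Phi(v)=\int_0^\infty dt\;\frac{e^{-t\theta\mu^2/(4\xi)}}{4\pi\sinh t}\,e^{-\xi\theta^{-1}|v|^2\coth t}.$$ The integral defining $\Phi(v)$ converges absolutely for all $v\neq0$, and the integral defining $K(x,y)$ converges absolutely for all $x,y$. For every $\psi\in L^2(\mathbb R^2)$ and almost every $x$, the integral $\int K(x,y)\psi(y)\,d^2y$ converges absolutely and equals $(L(a)(H_L+\mu^2)^{-1}\psi)(x)$. ii) If $\xi\neq1$, then for all $a\in\mathcal S(\mathbb R^2)$ and $\mu\in\mathbb R$ the operator $L(a)(H_L+\mu^2)^{-1}$ is Hilbert–Schmidt on $L^2(\mathbb R^2)$, with Hilbert–Schmidt norm at most $C\,\|a\|_2$, where $C=\left(\dfrac{\pi\theta}{64\,\xi\,(1+\xi)^2}\right)^{1/2}$. iii) Consequently, if $\xi\neq1$, then $L(a)(H_L+\mu^2)^{-1}$ is a compact operator on $L^2(\mathbb R^2)$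 for all $a\in\mathcal S(\mathbb R^2)$ and $\mu\in\mathbb R$, in particular for all $\mu\ne0$. -/

import Mathlib

open MeasureTheory Set
open scoped SchwartzMap LineDeriv ENNReal

noncomputable section

namespace LandauMoyal

/-- The Euclidean plane. -/
abbrev Plane : Type := EuclideanSpace ℝ (Fin 2)

/-- The complex Hilbert space of square integrable functions on the plane. -/
abbrev L2Plane : Type := Lp ℂ 2 (volume : Measure Plane)

/-- The class in `L²` of a Schwartz function. -/
def toL2 : 𝓢(Plane, ℂ) →L[ℂ] L2Plane := SchwartzMap.toLpCLM ℂ ℂ 2 volume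

theorem toL2_injective : Function.Injective toL2 :=
  SchwartzMap.injective_toLp (F := ℂ) 2 (volume : Measure Plane)

/-! ### The Moyal product -/

/-- The deformation matrix `Θ`. -/
def Theta (θ : ℝ) : Matrix (Fin 2) (Fin 2) ℝ := θ • !![0, 1; -1, 0]

/-- The bilinear form `x Θ⁻¹ y = x^μ Θ⁻¹_{μν} y^ν`, in coordinates. -/
def thetaForm (θ : ℝ) (x y : Plane) : ℝ := (x 1 * y 0 - x 0 * y 1) / θ

theorem Theta_inv {θ : ℝ} (hθ : θ ≠ 0) : (Theta θ)⁻¹ = !![0, -θ⁻¹; θ⁻¹, 0] := by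
  refine Matrix.inv_eq_right_inv ?_
  ext i j
  fin_cases i <;> fin_cases j <;> simp [Theta, Matrix.mul_apply, Fin.sum_univ_two, hθ]

theorem thetaForm_eq {θ : ℝ} (hθ : θ ≠ 0) (x y : Plane) :
    thetaForm θ x y = ∑ i, ∑ j, x i * (Theta θ)⁻¹ i j * y j := by
  rw [Theta_inv hθ]
  simp only [thetaForm, Fin.sum_univ_two]
  simp
  ring

/-- The Moyal product
`(f ⋆ g)(x) = (πθ)⁻² ∫ d²y d²z f(x + y) g(x + z) exp(-2i y Θ⁻¹ z)`. -/
def moyal (θ : ℝ) (f g : Plane → ℂ) (x : Plane) : ℂ :=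
  (1 / (Real.pi * θ) ^ 2 : ℝ) *
    ∫ p : Plane × Plane,
      f (x + p.1) * g (x + p.2) * Complex.exp (-2 * Complex.I * (thetaForm θ p.1 p.2 : ℝ))

/-- `L` is the operator `L(a)` of left Moyal multiplication by `a` on `L²`: the bounded operator
that maps every Schwartz function `f` to `a ⋆ f`. -/
def IsMoyalLeft (θ : ℝ) (a : 𝓢(Plane, ℂ)) (L : L2Plane →L[ℂ] L2Plane) : Prop :=
  ∀ f : 𝓢(Plane, ℂ), (L (toL2 f) : Plane → ℂ) =ᵐ[volume] moyal θ a f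

/-- There is at most one left multiplication operator, because Schwartz functions are dense. -/
theorem IsMoyalLeft.unique {θ : ℝ} {a : 𝓢(Plane, ℂ)} {L L' : L2Plane →L[ℂ] L2Plane}
    (h : IsMoyalLeft θ a L) (h' : IsMoyalLeft θ a L') : L = L' := by
  have hd : DenseRange toL2 :=
    SchwartzMap.denseRange_toLpCLM (E := Plane) (F := ℂ) (p := 2) (by simp)
  refine ContinuousLinearMap.coeFn_injective
    (hd.equalizer L.continuous L'.continuous (funext fun f => ?_))
  exact Lp.ext ((h f).trans (h' f).symm)

/-! ### The Landau Hamiltonian -/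

/-- The function `x̃_i = 2 Θ⁻¹_{ij} x^j`, that is `x̃ = (2/θ) (-x², x¹)`. -/
def xTilde (θ : ℝ) (i : Fin 2) (x : Plane) : ℝ := 2 / θ * (![-(x 1), x 0] i)

theorem xTilde_eq {θ : ℝ} (hθ : θ ≠ 0) (i : Fin 2) (x : Plane) :
    xTilde θ i x = 2 * ∑ j, (Theta θ)⁻¹ i j * x j := by
  rw [Theta_inv hθ]
  fin_cases i <;> simp [xTilde, Fin.sum_univ_two] <;> ring

theorem xTilde_hasTemperateGrowth (θ : ℝ) (i : Fin 2) :
    (xTilde θ i).HasTemperateGrowth := by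
  have h : ∀ j : Fin 2, (fun x : Plane => x j).HasTemperateGrowth := fun j =>
    (EuclideanSpace.proj j : EuclideanSpace ℝ (Fin 2) →L[ℝ] ℝ).hasTemperateGrowth
  have h0 := h 0
  have h1 := h 1
  fin_cases i
  · have e : xTilde θ ((fun i => i) ⟨0, by decide⟩) = fun x : Plane => -(2 / θ) * x 1 := by
      funext x
      simp [xTilde]
    rw [e]
    fun_prop
  · have e : xTilde θ ((fun i => i) ⟨1, by decide⟩) = fun x : Plane => (2 / θ) * x 0 := by
      funext x
      simp [xTilde]
    rw [e]
    fun_prop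

/-- Multiplication by `x̃_i` on Schwartz functions. -/
def mulTilde (θ : ℝ) (i : Fin 2) : 𝓢(Plane, ℂ) →L[ℂ] 𝓢(Plane, ℂ) :=
  SchwartzMap.smulLeftCLM ℂ (fun x => (xTilde θ i x : ℂ))

theorem mulTilde_apply (θ : ℝ) (i : Fin 2) (f : 𝓢(Plane, ℂ)) (x : Plane) :
    mulTilde θ i f x = (xTilde θ i x : ℂ) * f x := by
  have h : (fun x : Plane => (xTilde θ i x : ℂ)).HasTemperateGrowth := by
    have := xTilde_hasTemperateGrowth θ i
    exact Complex.ofRealCLM.hasTemperateGrowth.comp this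
  rw [mulTilde, SchwartzMap.smulLeftCLM_apply_apply h, smul_eq_mul]

/-- The partial derivative `∂_i` on Schwartz functions. -/
def partialD (i : Fin 2) : 𝓢(Plane, ℂ) →L[ℂ] 𝓢(Plane, ℂ) :=
  LineDeriv.lineDerivOpCLM ℂ 𝓢(Plane, ℂ) (EuclideanSpace.single i (1 : ℝ))

theorem partialD_apply (i : Fin 2) (f : 𝓢(Plane, ℂ)) (x : Plane) :
    partialD i f x = lineDeriv ℝ f x (EuclideanSpace.single i (1 : ℝ)) := by
  exact SchwartzMap.lineDerivOp_apply (EuclideanSpace.single i (1 : ℝ)) f x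

/-- The Landau operator `-∂² + ξ² x̃² - 2iξ x̃_μ ∂_μ` on Schwartz functions. -/
def landauSchwartz (θ ξ : ℝ) : 𝓢(Plane, ℂ) →L[ℂ] 𝓢(Plane, ℂ) :=
  ∑ i : Fin 2, (-(partialD i ∘L partialD i) + ((ξ : ℂ) ^ 2) • (mulTilde θ i ∘L mulTilde θ i)
    - (2 * Complex.I * (ξ : ℂ)) • (mulTilde θ i ∘L partialD i))

/-- The Landau operator as an unbounded operator on `L²` with domain the Schwartz functions. -/
def landauMin (θ ξ : ℝ) : L2Plane →ₗ.[ℂ] L2Plane where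
  domain := LinearMap.range (toL2 : 𝓢(Plane, ℂ) →ₗ[ℂ] L2Plane)
  toFun := (toL2 : 𝓢(Plane, ℂ) →ₗ[ℂ] L2Plane) ∘ₗ (landauSchwartz θ ξ : 𝓢(Plane, ℂ) →ₗ[ℂ] 𝓢(Plane, ℂ))
    ∘ₗ ((LinearEquiv.ofInjective (toL2 : 𝓢(Plane, ℂ) →ₗ[ℂ] L2Plane) toL2_injective).symm :
      LinearMap.range (toL2 : 𝓢(Plane, ℂ) →ₗ[ℂ] L2Plane) →ₗ[ℂ] 𝓢(Plane, ℂ))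

theorem landauMin_apply (θ ξ : ℝ) (f : 𝓢(Plane, ℂ)) (h : toL2 f ∈ (landauMin θ ξ).domain) :
    landauMin θ ξ ⟨toL2 f, h⟩ = toL2 (landauSchwartz θ ξ f) := by
  have e : (LinearEquiv.ofInjective (toL2 : 𝓢(Plane, ℂ) →ₗ[ℂ] L2Plane) toL2_injective).symm
      ⟨toL2 f, h⟩ = f := by
    rw [LinearEquiv.symm_apply_eq]
    rfl
  exact congrArg (fun g => toL2 (landauSchwartz θ ξ g)) e

/-- The Landau Hamiltonian `H_L` on `L²`: the closure of the Landau operator on Schwartz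
functions. -/
def landauHamiltonian (θ ξ : ℝ) : L2Plane →ₗ.[ℂ] L2Plane := (landauMin θ ξ).closure

/-- `R` is the everywhere defined bounded (two-sided) inverse of `A + c`. -/
def IsBoundedInverse {H : Type*} [NormedAddCommGroup H] [NormedSpace ℂ H]
    (A : H →ₗ.[ℂ] H) (c : ℂ) (R : H →L[ℂ] H) : Prop :=
  (∀ f : H, ∃ h : R f ∈ A.domain, A ⟨R f, h⟩ + c • R f = f) ∧
    ∀ g : A.domain, R (A g + c • (g : H)) = g

theorem IsBoundedInverse.unique {H : Type*} [NormedAddCommGroup H] [NormedSpace ℂ H]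
    {A : H →ₗ.[ℂ] H} {c : ℂ} {R R' : H →L[ℂ] H}
    (h : IsBoundedInverse A c R) (h' : IsBoundedInverse A c R') : R = R' := by
  ext f
  obtain ⟨hf, e⟩ := h'.1 f
  have := h.2 ⟨R' f, hf⟩
  simpa [e] using this

/-! ### Integral kernels and Hilbert–Schmidt operators -/

/-- `K` is an integral kernel of the bounded operator `T` on `L²`: for every `ψ` and almost every
`x` the integral `∫ K(x, y) ψ(y) dy` converges absolutely and equals `(T ψ)(x)`. -/
def HasIntegralKernel (T : L2Plane →L[ℂ] L2Plane) (K : Plane → Plane → ℂ) : Prop :=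
  ∀ ψ : L2Plane, ∀ᵐ x : Plane,
    Integrable (fun y => K x y * ψ y) ∧ T ψ x = ∫ y, K x y * ψ y

/-- `T` is a Hilbert–Schmidt operator with Hilbert–Schmidt norm `(∑ ‖T e_i‖²)^{1/2}` at most `C`,
in every orthonormal basis. -/
def HilbertSchmidtNormLE {H : Type*} [NormedAddCommGroup H] [InnerProductSpace ℂ H]
    (T : H →L[ℂ] H) (C : ℝ) : Prop :=
  ∀ (ι : Type) (b : HilbertBasis ι ℂ H),
    Summable (fun i => ‖T (b i)‖ ^ 2) ∧ √(∑' i, ‖T (b i)‖ ^ 2) ≤ C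

/-- The integrand of `Φ(v)`, on `t > 0`. -/
def phiIntegrand (θ ξ μ : ℝ) (v : Plane) (t : ℝ) : ℝ :=
  Real.exp (-(t * (θ * μ ^ 2 / (4 * ξ)))) / (4 * Real.pi * Real.sinh t) *
    Real.exp (-(ξ / θ * ‖v‖ ^ 2 * (Real.cosh t / Real.sinh t)))

/-- `Φ(v) = ∫₀^∞ dt exp(-t θ μ² / (4ξ)) / (4π sinh t) exp(-ξ θ⁻¹ |v|² coth t)`. -/
def Phi (θ ξ μ : ℝ) (v : Plane) : ℝ := ∫ t in Ioi 0, phiIntegrand θ ξ μ v t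

/-- The integrand, as a function of `p = (u, v)`, of the kernel of `L(a) (H_L + μ²)⁻¹`. -/
def kernelIntegrand (θ ξ μ : ℝ) (a : 𝓢(Plane, ℂ)) (x y : Plane) (p : Plane × Plane) : ℂ :=
  a p.1 * (Phi θ ξ μ p.2 : ℂ) *
    Complex.exp (2 * Complex.I * (thetaForm θ x (p.2 - p.1) : ℝ)) *
    Complex.exp (2 * Complex.I * (thetaForm θ y (p.1 + ξ • p.2) : ℝ)) *
    Complex.exp (-2 * Complex.I * (thetaForm θ p.1 p.2 : ℝ))

/-- The kernel of `L(a) (H_L + μ²)⁻¹`. -/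
def kernel (θ ξ μ : ℝ) (a : 𝓢(Plane, ℂ)) (x y : Plane) : ℂ :=
  Complex.exp (2 * Complex.I * (thetaForm θ x y : ℝ)) / ((Real.pi * θ) ^ 2 : ℝ) *
    ∫ p : Plane × Plane, kernelIntegrand θ ξ μ a x y p

end LandauMoyal

end

/-! The Landau operator is `-∑ (∂_i + iξ x̃_i)²`, because `x̃_i` does not depend on `x_i`. Applied
to a Gaussian `y ↦ exp(2iξ xΘ⁻¹y - b|x - y|²)` it multiplies it by `4b + 4((ξ/θ)² - b²)|x - y|²`
(`landauSchwartz_magGauss`). Letting `b = (ξ/θ) coth t` solve the resulting Riccati equation gives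
the Mehler kernel of the heat flow of `H_L + μ²`, with time scaled by `θ/(4ξ)`. Its integral over
`t` is `Φ(x - y)` times a phase, and `Φ ∈ L¹`, so by the Schur test this kernel defines a bounded
symmetric operator `R`.

That `R` inverts the closure of the operator needs no spectral theory. For Schwartz `f`, the
fundamental theorem of calculus in `t`, between the approximate identity at `0` and decay at `∞`,
gives `R (H_L + μ²) f = f` (`resolvent_landauSchwartz`). Symmetry of `R` and density then make `R`
injective, which yields closability. A vector orthogonal to `(H_L + μ²)𝓢` has a heat evolution that
is constant in `t` and vanishes at `∞`, so it lies in the kernel of `R` and is zero. The range is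
therefore dense, and closedness of the graph extends the right inverse property to all of `L²`
(`isBoundedInverse_resolvent`).

Left Moyal multiplication is also a twisted convolution, with a rescaled symplectic Fourier
transform `â` of `a` as its convolution function. Composing the two kernels gives the stated `K`. On
the diagonal `y = x + q`, `K` is a phase times the Fourier transform of `p ↦ â(p) Φ(p - q)` at a
point that depends on `x` through `(1 + ξ)x` (`kernel_add_right`). Plancherel in `x`, then Tonelli
in `q`, bound `‖K‖²` by `(πθ)²/(1 + ξ)² · ‖â‖² ‖Φ‖²`. Here `‖â‖² ≤ ‖a‖²/(πθ)²`, and `‖Φ‖² ≤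
πθ/(64ξ)` comes from `∫∫ dt ds / sinh(t + s) = π²/4`. A square integrable kernel gives a
Hilbert–Schmidt operator, hence a compact one. -/

noncomputable section

namespace LandauMoyal

/-! ### The Schur test and operators with integral kernels -/

section Schur

open scoped NNReal

variable {α : Type*} [MeasurableSpace α] {μ : Measure α}

/-- Cauchy-Schwarz with respect to a weight. -/
theorem lintegral_mul_sq_le {k f : α → ℝ≥0∞} (hk : AEMeasurable k μ) (hf : AEMeasurable f μ) :
    (∫⁻ x, k x * f x ∂μ) ^ 2 ≤ (∫⁻ x, k x ∂μ) * ∫⁻ x, k x * f x ^ 2 ∂μ := by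
  have h := ENNReal.lintegral_mul_le_Lp_mul_Lq μ Real.HolderConjugate.two_two
    (hk.pow_const (1 / 2 : ℝ)) ((hk.pow_const (1 / 2 : ℝ)).mul hf)
  have e (c : ℝ≥0∞) : c ^ (1 / 2 : ℝ) * c ^ (1 / 2 : ℝ) = c := by
    rw [← ENNReal.rpow_add_of_nonneg _ _ (by norm_num) (by norm_num)]
    norm_num
  have e' (c : ℝ≥0∞) : (c ^ (1 / 2 : ℝ)) ^ (2 : ℝ) = c := by
    rw [← ENNReal.rpow_mul]
    norm_num
  have e'' (c : ℝ≥0∞) : (c ^ (1 / 2 : ℝ)) ^ 2 = c := by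
    rw [pow_two, e]
  simp only [Pi.mul_apply, ← mul_assoc, e, e', ENNReal.mul_rpow_of_nonneg _ _ zero_le_two,
    ENNReal.rpow_two] at h
  calc _ ≤ _ := pow_le_pow_left₀ zero_le h 2
    _ = _ := by simp only [mul_pow, e'']

/-- The hypotheses of the Schur test for an integral kernel. -/
structure IsSchurKernel (μ : Measure α) (N : α → α → ℂ) (M : ℝ≥0) : Prop where
  measurable : Measurable (Function.uncurry N)
  left_le : ∀ x, ∫⁻ y, ‖N x y‖ₑ ∂μ ≤ M
  right_le : ∀ y, ∫⁻ x, ‖N x y‖ₑ ∂μ ≤ M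

variable {N : α → α → ℂ} {M : ℝ≥0}

theorem IsSchurKernel.measurable_left (h : IsSchurKernel μ N M) (x : α) : Measurable (N x) :=
  h.measurable.comp measurable_prodMk_left

theorem lintegral_enorm_sq_lt_top (ψ : Lp ℂ 2 μ) : ∫⁻ y, ‖ψ y‖ₑ ^ 2 ∂μ < ∞ := by
  have := lintegral_rpow_enorm_lt_top_of_eLpNorm_lt_top two_ne_zero (by simp) (Lp.memLp ψ).2
  simpa using this

theorem Lp_enorm_sq (ψ : Lp ℂ 2 μ) : ‖ψ‖ₑ ^ 2 = ∫⁻ y, ‖ψ y‖ₑ ^ 2 ∂μ := by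
  rw [Lp.enorm_def, eLpNorm_eq_lintegral_rpow_enorm_toReal two_ne_zero (by simp),
    ← ENNReal.rpow_natCast, ← ENNReal.rpow_mul]
  simp

theorem IsSchurKernel.aestronglyMeasurable (h : IsSchurKernel μ N M) (ψ : Lp ℂ 2 μ) (x : α) :
    AEStronglyMeasurable (fun y => N x y * ψ y) μ :=
  (h.measurable_left x).aestronglyMeasurable.mul (Lp.aestronglyMeasurable ψ)

variable [SFinite μ]

/-- Cauchy–Schwarz with weight `|N x ·|` costs one row bound `M`; after Tonelli the column bound
gives the second. -/
theorem IsSchurKernel.lintegral_sq_le (h : IsSchurKernel μ N M) {f : α → ℝ≥0∞}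
    (hf : AEMeasurable f μ) :
    ∫⁻ x, (∫⁻ y, ‖N x y‖ₑ * f y ∂μ) ^ 2 ∂μ ≤ M ^ 2 * ∫⁻ y, f y ^ 2 ∂μ := by
  have hm : AEMeasurable (fun p : α × α => ‖N p.1 p.2‖ₑ * f p.2 ^ 2) (μ.prod μ) :=
    h.measurable.enorm.aemeasurable.mul ((hf.comp_quasiMeasurePreserving
      Measure.quasiMeasurePreserving_snd).pow_const 2)
  calc ∫⁻ x, (∫⁻ y, ‖N x y‖ₑ * f y ∂μ) ^ 2 ∂μ
      ≤ ∫⁻ x, M * ∫⁻ y, ‖N x y‖ₑ * f y ^ 2 ∂μ ∂μ := by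
        refine lintegral_mono fun x => ?_
        exact (lintegral_mul_sq_le (h.measurable_left x).enorm.aemeasurable hf).trans
          (mul_le_mul_left (h.left_le x) _)
    _ = M * ∫⁻ y, ∫⁻ x, ‖N x y‖ₑ * f y ^ 2 ∂μ ∂μ := by
        rw [lintegral_const_mul' _ _ ENNReal.coe_ne_top, lintegral_lintegral_swap hm]
    _ ≤ M * ∫⁻ y, M * f y ^ 2 ∂μ := by
        gcongr with y
        have hy : Measurable fun x => N x y := h.measurable.comp measurable_prodMk_right
        rw [lintegral_mul_const _ hy.enorm]
        gcongr
        exact h.right_le y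
    _ = _ := by rw [lintegral_const_mul' _ _ ENNReal.coe_ne_top]; ring

theorem IsSchurKernel.lintegral_mul_sq_lt_top (h : IsSchurKernel μ N M) (ψ : Lp ℂ 2 μ) :
    ∫⁻ x, (∫⁻ y, ‖N x y‖ₑ * ‖ψ y‖ₑ ∂μ) ^ 2 ∂μ < ∞ :=
  (h.lintegral_sq_le (Lp.aestronglyMeasurable ψ).enorm).trans_lt
    (ENNReal.mul_lt_top (by simp) (lintegral_enorm_sq_lt_top ψ))

theorem IsSchurKernel.aemeasurable_lintegral (h : IsSchurKernel μ N M) (ψ : Lp ℂ 2 μ) :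
    AEMeasurable (fun x => ∫⁻ y, ‖N x y‖ₑ * ‖ψ y‖ₑ ∂μ) μ := by
  have : AEMeasurable (fun p : α × α => ‖N p.1 p.2‖ₑ * ‖ψ p.2‖ₑ) (μ.prod μ) :=
    h.measurable.enorm.aemeasurable.mul ((Lp.aestronglyMeasurable ψ).enorm.comp_quasiMeasurePreserving
      Measure.quasiMeasurePreserving_snd)
  exact this.lintegral_prod_right'

theorem IsSchurKernel.ae_integrable (h : IsSchurKernel μ N M) (ψ : Lp ℂ 2 μ) :
    ∀ᵐ x ∂μ, Integrable (fun y => N x y * ψ y) μ := by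
  filter_upwards [ae_lt_top' ((h.aemeasurable_lintegral ψ).pow_const 2)
    (h.lintegral_mul_sq_lt_top ψ).ne] with x hx
  refine ⟨h.aestronglyMeasurable ψ x, ?_⟩
  simpa [HasFiniteIntegral, enorm_mul] using hx

theorem IsSchurKernel.eLpNorm_integral_le (h : IsSchurKernel μ N M) (ψ : Lp ℂ 2 μ) :
    eLpNorm (fun x => ∫ y, N x y * ψ y ∂μ) 2 μ ≤ M * ‖ψ‖ₑ := by
  rw [eLpNorm_eq_lintegral_rpow_enorm_toReal two_ne_zero (by simp), one_div,
    ENNReal.rpow_inv_le_iff (by simp)]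
  simp only [ENNReal.toReal_ofNat, ENNReal.rpow_two, mul_pow, Lp_enorm_sq]
  refine le_trans (lintegral_mono fun x => ?_)
    (h.lintegral_sq_le (Lp.aestronglyMeasurable ψ).enorm)
  gcongr
  refine (enorm_integral_le_lintegral_enorm _).trans (le_of_eq ?_)
  simp only [enorm_mul]

theorem IsSchurKernel.memLp (h : IsSchurKernel μ N M) (ψ : Lp ℂ 2 μ) :
    MemLp (fun x => ∫ y, N x y * ψ y ∂μ) 2 μ := by
  refine ⟨?_, (h.eLpNorm_integral_le ψ).trans_lt (ENNReal.mul_lt_top (by simp) (by simp))⟩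
  exact (h.measurable.aestronglyMeasurable.mul ((Lp.aestronglyMeasurable ψ).comp_snd
    (μ := μ))).integral_prod_right'

/-- The bounded operator defined by a kernel that satisfies the hypotheses of the Schur test. -/
def IsSchurKernel.op (h : IsSchurKernel μ N M) : Lp ℂ 2 μ →L[ℂ] Lp ℂ 2 μ :=
  LinearMap.mkContinuous
    { toFun := fun ψ => (h.memLp ψ).toLp
      map_add' := fun φ ψ => by
        rw [← MemLp.toLp_add]
        refine MemLp.toLp_congr _ _ ?_
        filter_upwards [h.ae_integrable φ, h.ae_integrable ψ] with x h1 h2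
        rw [Pi.add_apply, ← integral_add h1 h2]
        refine integral_congr_ae ?_
        filter_upwards [Lp.coeFn_add φ ψ] with y hy
        rw [hy, Pi.add_apply, mul_add]
      map_smul' := fun c ψ => by
        rw [RingHom.id_apply, ← MemLp.toLp_const_smul]
        refine MemLp.toLp_congr _ _ ?_
        filter_upwards with x
        rw [Pi.smul_apply, smul_eq_mul, ← integral_const_mul]
        refine integral_congr_ae ?_
        filter_upwards [Lp.coeFn_smul c ψ] with y hy
        rw [hy, Pi.smul_apply, smul_eq_mul]
        ring }
    M fun ψ => by
      have := h.eLpNorm_integral_le ψ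
      rw [← ENNReal.toReal_le_toReal ((h.memLp ψ).2.ne) (by finiteness)] at this
      simpa [Lp.norm_toLp] using this

theorem IsSchurKernel.op_apply_ae (h : IsSchurKernel μ N M) (ψ : Lp ℂ 2 μ) :
    (h.op ψ : α → ℂ) =ᵐ[μ] fun x => ∫ y, N x y * ψ y ∂μ :=
  (h.memLp ψ).coeFn_toLp

/-- This is Fubini. The double integral converges absolutely because `φ` and `x ↦ ∫ |N x y| |ψ y|`
are both square integrable. -/
theorem IsSchurKernel.inner_op_left (h : IsSchurKernel μ N M)
    (hN : ∀ x y, N x y = starRingEnd ℂ (N y x)) (φ ψ : Lp ℂ 2 μ) :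
    inner ℂ (h.op φ) ψ = inner ℂ φ (h.op ψ) := by
  have hi : Integrable (fun p : α × α => starRingEnd ℂ (φ p.1) * (N p.1 p.2 * ψ p.2))
      (μ.prod μ) := by
    have hm : AEStronglyMeasurable (fun p : α × α => starRingEnd ℂ (φ p.1) * (N p.1 p.2 * ψ p.2))
        (μ.prod μ) :=
      (Complex.continuous_conj.comp_aestronglyMeasurable (Lp.aestronglyMeasurable φ).comp_fst).mul
        (h.measurable.aestronglyMeasurable.mul (Lp.aestronglyMeasurable ψ).comp_snd)
    refine ⟨hm, ?_⟩
    rw [HasFiniteIntegral, lintegral_prod _ hm.enorm]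
    have h2 : ∀ x, ∫⁻ y, ‖starRingEnd ℂ (φ x) * (N x y * ψ y)‖ₑ ∂μ
        = ‖φ x‖ₑ * ∫⁻ y, ‖N x y‖ₑ * ‖ψ y‖ₑ ∂μ := fun x => by
      rw [← lintegral_const_mul' _ _ (by simp)]
      simp [enorm_mul]
    simp only [h2]
    refine (ENNReal.lintegral_mul_le_Lp_mul_Lq μ Real.HolderConjugate.two_two
      (Lp.aestronglyMeasurable φ).enorm (h.aemeasurable_lintegral ψ)).trans_lt ?_
    refine ENNReal.mul_lt_top ?_ ?_ <;> refine ENNReal.rpow_lt_top_of_nonneg (by norm_num) ?_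
    · simpa using (lintegral_enorm_sq_lt_top φ).ne
    · simpa using (h.lintegral_mul_sq_lt_top ψ).ne
  rw [L2.inner_def, L2.inner_def]
  calc ∫ y, inner ℂ (h.op φ y) (ψ y) ∂μ
      = ∫ y, ∫ x, starRingEnd ℂ (φ x) * (N x y * ψ y) ∂μ ∂μ := by
        refine integral_congr_ae ?_
        filter_upwards [h.op_apply_ae φ] with y hy
        rw [RCLike.inner_apply, hy, ← integral_conj, ← integral_const_mul]
        refine integral_congr_ae (ae_of_all _ fun x => ?_)
        simp only [map_mul]
        rw [← hN]
        ring
    _ = ∫ x, ∫ y, starRingEnd ℂ (φ x) * (N x y * ψ y) ∂μ ∂μ :=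
        (integral_integral_swap hi).symm
    _ = _ := by
        refine integral_congr_ae ?_
        filter_upwards [h.op_apply_ae ψ] with x hx
        rw [RCLike.inner_apply, hx, integral_const_mul, mul_comm]

/-- The Schur bound for `N`, applied to the square integrable function `w ↦ ∫ |N' w y| |ψ y|`, shows
that for almost every `x` the double integral over `(w, y)` converges absolutely. Fubini then
applies at that `x`. -/
theorem IsSchurKernel.op_comp_op {N' : α → α → ℂ} {M' : ℝ≥0} (h : IsSchurKernel μ N M)
    (h' : IsSchurKernel μ N' M') (ψ : Lp ℂ 2 μ) : ∀ᵐ x ∂μ,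
    Integrable (fun y => (∫ w, N x w * N' w y ∂μ) * ψ y) μ ∧
      h.op (h'.op ψ) x = ∫ y, (∫ w, N x w * N' w y ∂μ) * ψ y ∂μ := by
  have hfin : ∀ᵐ x ∂μ, ∫⁻ w, ‖N x w‖ₑ * ∫⁻ y, ‖N' w y‖ₑ * ‖ψ y‖ₑ ∂μ ∂μ < ∞ := by
    have hm : AEMeasurable (fun p : α × α => ‖N p.1 p.2‖ₑ * ∫⁻ y, ‖N' p.2 y‖ₑ * ‖ψ y‖ₑ ∂μ)
        (μ.prod μ) :=
      h.measurable.enorm.aemeasurable.mul ((h'.aemeasurable_lintegral ψ).comp_quasiMeasurePreserving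
        Measure.quasiMeasurePreserving_snd)
    have := ae_lt_top' (hm.lintegral_prod_right'.pow_const 2)
      ((h.lintegral_sq_le (h'.aemeasurable_lintegral ψ)).trans_lt
        (ENNReal.mul_lt_top (by simp) (h'.lintegral_mul_sq_lt_top ψ))).ne
    filter_upwards [this] with x hx
    simpa using hx
  filter_upwards [hfin, h.op_apply_ae (h'.op ψ)] with x hx hop
  have hm : AEStronglyMeasurable (fun p : α × α => N x p.1 * (N' p.1 p.2 * ψ p.2)) (μ.prod μ) :=
    (h.measurable_left x).aestronglyMeasurable.comp_fst.mul
      (h'.measurable.aestronglyMeasurable.mul (Lp.aestronglyMeasurable ψ).comp_snd)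
  have hi : Integrable (fun p : α × α => N x p.1 * (N' p.1 p.2 * ψ p.2)) (μ.prod μ) := by
    refine ⟨hm, ?_⟩
    rw [HasFiniteIntegral, lintegral_prod _ hm.enorm]
    refine lt_of_eq_of_lt (lintegral_congr fun w => ?_) hx
    rw [← lintegral_const_mul' _ _ (by simp)]
    simp [enorm_mul]
  have e : ∀ y, ∫ w, N x w * (N' w y * ψ y) ∂μ = (∫ w, N x w * N' w y ∂μ) * ψ y := fun y => by
    rw [← integral_mul_const]
    simp only [mul_assoc]
  refine ⟨?_, ?_⟩
  · simpa only [e] using hi.integral_prod_right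
  · simp only [← e]
    rw [← integral_integral_swap hi, hop]
    refine integral_congr_ae ?_
    filter_upwards [h'.op_apply_ae ψ] with w hw
    rw [hw, integral_const_mul]

end Schur

/-! ### Hilbert–Schmidt operators: square integrable kernels and compactness -/

section HilbertSchmidt

/-- An operator with a square integrable kernel is Hilbert-Schmidt. -/
theorem hilbertSchmidtNormLE_of_kernel {α : Type*} [MeasurableSpace α] {μ : Measure α} [SFinite μ]
    {T : Lp ℂ 2 μ →L[ℂ] Lp ℂ 2 μ} {K : α → α → ℂ} (hm : Measurable (Function.uncurry K))
    (hT : ∀ ψ : Lp ℂ 2 μ, (T ψ : α → ℂ) =ᵐ[μ] fun x => ∫ y, K x y * ψ y ∂μ) {C : ℝ} (hC : 0 ≤ C)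
    (hK : ∫⁻ x, ∫⁻ y, ‖K x y‖ₑ ^ 2 ∂μ ∂μ ≤ ENNReal.ofReal (C ^ 2)) :
    HilbertSchmidtNormLE T C := by
  intro ι b
  have hmx : ∀ x, Measurable (K x) := fun x => hm.comp measurable_prodMk_left
  have hfin : ∀ᵐ x ∂μ, ∫⁻ y, ‖K x y‖ₑ ^ 2 ∂μ < ∞ :=
    ae_lt_top ((hm.enorm.pow_const 2).lintegral_prod_right') (hK.trans_lt (by simp)).ne
  -- The index set may be uncountable, so only finite sums are handled: the exceptional null sets of
  -- finitely many `T (b i)` can be discarded together.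
  have hsum : ∀ s : Finset ι, ∑ i ∈ s, ‖T (b i)‖ ^ 2 ≤ C ^ 2 := fun s => by
    have h1 : ∑ i ∈ s, ‖T (b i)‖ₑ ^ 2 ≤ ENNReal.ofReal (C ^ 2) := by
      refine le_trans ?_ hK
      simp only [Lp_enorm_sq]
      rw [← lintegral_finsetSum' _ fun i _ => (Lp.aestronglyMeasurable (T (b i))).enorm.pow_const 2]
      refine lintegral_mono_ae ?_
      have hall : ∀ᵐ x ∂μ, ∀ i ∈ s, T (b i) x = ∫ y, K x y * b i y ∂μ :=
        (ae_ball_iff s.countable_toSet).2 fun i _ => hT (b i)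
      filter_upwards [hall, hfin] with x hx hxf
      have hk : MemLp (fun y => starRingEnd ℂ (K x y)) 2 μ := by
        refine ⟨(Complex.continuous_conj.measurable.comp (hmx x)).aestronglyMeasurable, ?_⟩
        rw [eLpNorm_lt_top_iff_lintegral_rpow_enorm_lt_top two_ne_zero (by simp)]
        simpa using hxf
      -- At fixed `x`, `T (b i) x` is a Fourier coefficient of the conjugate of `K x ·`; Bessel's
      -- inequality at that `x` is then integrated over `x`.
      have hin : ∀ i ∈ s, T (b i) x = inner ℂ hk.toLp (b i) := fun i hi => by
        rw [hx i hi, L2.inner_def]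
        refine integral_congr_ae ?_
        filter_upwards [hk.coeFn_toLp] with y hy
        rw [hy, RCLike.inner_apply]
        simp [mul_comm]
      have hb : ∑ i ∈ s, ‖(T (b i) : α → ℂ) x‖ ^ 2 ≤ ‖hk.toLp‖ ^ 2 := by
        refine le_trans (le_of_eq (Finset.sum_congr rfl fun i hi => ?_))
          (b.orthonormal.sum_inner_products_le (x := hk.toLp) (s := s))
        rw [hin i hi, norm_inner_symm]
      have hkn : ‖hk.toLp‖ₑ ^ 2 = ∫⁻ y, ‖K x y‖ₑ ^ 2 ∂μ := by
        rw [Lp_enorm_sq]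
        refine lintegral_congr_ae ?_
        filter_upwards [hk.coeFn_toLp] with y hy
        rw [hy]
        congr 1
        exact RCLike.enorm_conj _
      rw [← hkn]
      have := ENNReal.ofReal_le_ofReal hb
      rw [ENNReal.ofReal_sum_of_nonneg fun i _ => by positivity] at this
      simpa only [ENNReal.ofReal_pow (norm_nonneg _), ofReal_norm] using this
    rw [← ENNReal.ofReal_le_ofReal_iff (by positivity),
      ENNReal.ofReal_sum_of_nonneg fun i _ => by positivity]
    simpa only [ENNReal.ofReal_pow (norm_nonneg _), ofReal_norm] using h1
  have hs : Summable fun i => ‖T (b i)‖ ^ 2 :=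
    summable_of_sum_le (fun i => by positivity) hsum
  refine ⟨hs, ?_⟩
  rw [Real.sqrt_le_left hC]
  exact hs.tsum_le_of_sum_le hsum

/-- Hilbert-Schmidt operators are compact. -/
theorem HilbertSchmidtNormLE.isCompactOperator {H : Type} [NormedAddCommGroup H]
    [InnerProductSpace ℂ H] [CompleteSpace H] {T : H →L[ℂ] H} {C : ℝ}
    (h : HilbertSchmidtNormLE T C) : IsCompactOperator T := by
  classical
  obtain ⟨w, b, -⟩ := exists_hilbertBasis ℂ H
  obtain ⟨hs, -⟩ := h w b
  -- Finite rank truncations of `T` to the span of finitely many basis vectors; they are shown to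
  -- converge to `T` in operator norm.
  let F : Finset w → (H →L[ℂ] H) := fun s =>
    ∑ i ∈ s, (innerSL ℂ (b i)).smulRight (T (b i))
  have hF : ∀ s x, F s x = ∑ i ∈ s, inner ℂ (b i) x • T (b i) := fun s x => by
    simp [F]
  have hFc : ∀ s, IsCompactOperator (F s) := fun s => by
    have : F s ∈ compactOperator (RingHom.id ℂ) H H := by
      refine Submodule.sum_mem _ fun i _ => ?_
      have h1 : IsCompactOperator ((ContinuousLinearMap.id ℂ ℂ).smulRight (T (b i))) :=
        isCompactOperator_of_locallyCompactSpace_rng _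
      exact h1.comp_clm (innerSL ℂ (b i))
    exact this
  refine isCompactOperator_of_tendsto (l := Filter.atTop) (F := F) ?_ (Filter.Eventually.of_forall hFc)
  refine Metric.tendsto_atTop.2 fun ε hε => ?_
  have hε2 : (0 : ℝ) < (ε / 2) ^ 2 := by positivity
  obtain ⟨s, hs'⟩ := summable_iff_vanishing_norm.1 hs _ hε2
  refine ⟨s, fun n hn => ?_⟩
  rw [dist_eq_norm]
  refine lt_of_le_of_lt (ContinuousLinearMap.opNorm_le_bound _ (by positivity : 0 ≤ ε / 2)
    fun x => ?_) (by linarith)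
  have hx : HasSum (fun i => inner ℂ (b i) x • T (b i)) (T x) := by
    have := (b.hasSum_repr x).mapL T
    simpa [b.repr_apply_apply] using this
  have hlim : Filter.Tendsto (fun m : Finset w => ‖F n x - F m x‖) Filter.atTop
      (nhds ‖F n x - T x‖) := by
    refine (Filter.Tendsto.sub tendsto_const_nhds ?_).norm
    simp only [hF]
    exact hx
  -- `T x` is replaced by a larger partial sum `m ⊇ n`. Cauchy–Schwarz on `m \ n` then separates a
  -- tail of `∑ ‖T (b i)‖²` from a Bessel sum bounded by `‖x‖²`.
  refine le_of_tendsto hlim (Filter.eventually_atTop.2 ⟨n, fun m hm => ?_⟩)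
  rw [norm_sub_rev, hF, hF, ← Finset.sum_sdiff hm, add_sub_cancel_right]
  have hcs := Finset.sum_mul_sq_le_sq_mul_sq (m \ n) (fun i => ‖inner ℂ (b i) x‖)
    (fun i => ‖T (b i)‖)
  have h1 : ∑ i ∈ m \ n, ‖T (b i)‖ ^ 2 ≤ (ε / 2) ^ 2 := by
    have := hs' (m \ n) (Finset.disjoint_left.2 fun i hi hi' =>
      (Finset.mem_sdiff.1 hi).2 (hn hi'))
    rw [Real.norm_of_nonneg (Finset.sum_nonneg fun i _ => by positivity)] at this
    exact this.le
  have h2 : ∑ i ∈ m \ n, ‖inner ℂ (b i) x‖ ^ 2 ≤ ‖x‖ ^ 2 :=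
    b.orthonormal.sum_inner_products_le x
  calc ‖∑ i ∈ m \ n, inner ℂ (b i) x • T (b i)‖
      ≤ ∑ i ∈ m \ n, ‖inner ℂ (b i) x‖ * ‖T (b i)‖ :=
        (norm_sum_le _ _).trans (le_of_eq (by simp only [norm_smul]))
    _ ≤ ε / 2 * ‖x‖ := by
        refine (sq_le_sq₀ (by positivity) (by positivity)).1 (hcs.trans ?_)
        rw [mul_pow, mul_comm]
        exact mul_le_mul h1 h2 (by positivity) (by positivity)

end HilbertSchmidt

/-! ### Plancherel for the Fourier integral on `L¹ ∩ L²` -/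

section Plancherel

open FourierTransform

variable {V : Type*} [NormedAddCommGroup V] [InnerProductSpace ℝ V] [FiniteDimensional ℝ V]
  [MeasurableSpace V] [BorelSpace V]

/-- Plancherel's inequality for the integral formula of the Fourier transform. -/
theorem lintegral_fourier_sq_le {g : V → ℂ} (hg : Integrable g) (hg2 : MemLp g 2) :
    ∫⁻ ξ, ‖𝓕 g ξ‖ₑ ^ 2 ≤ ∫⁻ x, ‖g x‖ₑ ^ 2 := by
  have hc : Continuous (𝓕 g) := VectorFourier.fourierIntegral_continuous Real.continuous_fourierChar
    (L := innerₗ V) continuous_inner hg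
  -- The Fourier integral and the `L²` Fourier transform are compared as tempered distributions,
  -- each time by moving the transform onto the test function.
  have key : ∀ φ : 𝓢(V, ℂ), ∫ ξ, φ ξ • 𝓕 g ξ = ∫ ξ, φ ξ • (𝓕 hg2.toLp : Lp ℂ 2 volume) ξ := by
    intro φ
    rw [← Lp.toTemperedDistribution_apply, ← Lp.fourier_toTemperedDistribution_eq,
      TemperedDistribution.fourier_apply, Lp.toTemperedDistribution_apply]
    have h1 := VectorFourier.integral_fourierIntegral_smul_eq_flip (μ := (volume : Measure V))
      (ν := (volume : Measure V)) (L := innerₗ V) (f := φ) (g := g)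
      Real.continuous_fourierChar continuous_inner φ.integrable hg
    rw [flip_innerₗ] at h1
    refine h1.symm.trans (integral_congr_ae ?_)
    filter_upwards [hg2.coeFn_toLp] with x hx
    rw [hx]
    rfl
  have hG : LocallyIntegrable (𝓕 hg2.toLp : Lp ℂ 2 volume) volume :=
    (Lp.memLp _).locallyIntegrable (by norm_num)
  -- Two locally integrable functions with the same pairing against every compactly supported smooth
  -- function agree almost everywhere.
  have hae : ∀ᵐ ξ, 𝓕 g ξ - (𝓕 hg2.toLp : Lp ℂ 2 volume) ξ = 0 := by
    refine ae_eq_zero_of_integral_contDiff_smul_eq_zero (hc.locallyIntegrable.sub hG)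
      fun φ hφ hφc => ?_
    have hφ' : ContDiff ℝ ((⊤ : ℕ∞) : WithTop ℕ∞) (fun x => (φ x : ℂ)) := Complex.ofRealCLM.contDiff.comp hφ
    have hφc' : HasCompactSupport (fun x => (φ x : ℂ)) := hφc.comp_left Complex.ofReal_zero
    have h1 := key (hφc'.toSchwartzMap hφ')
    have hco : ∀ x, hφc'.toSchwartzMap hφ' x = φ x := fun x => rfl
    simp only [hco, Complex.coe_smul] at h1
    have e1 : Integrable fun ξ => φ ξ • 𝓕 g ξ :=
      hc.locallyIntegrable.integrable_smul_left_of_hasCompactSupport hφ.continuous hφc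
    have e2 : Integrable fun ξ => φ ξ • (𝓕 hg2.toLp : Lp ℂ 2 volume) ξ :=
      hG.integrable_smul_left_of_hasCompactSupport hφ.continuous hφc
    simp only [smul_sub]
    rw [integral_sub e1 e2, sub_eq_zero]
    exact h1
  have h3 : ∫⁻ ξ, ‖𝓕 g ξ‖ₑ ^ 2 = ‖(𝓕 hg2.toLp : Lp ℂ 2 volume)‖ₑ ^ 2 := by
    rw [Lp_enorm_sq]
    refine lintegral_congr_ae ?_
    filter_upwards [hae] with ξ hξ
    rw [sub_eq_zero.1 hξ]
  have h4 : ‖(𝓕 hg2.toLp : Lp ℂ 2 volume)‖ₑ = ‖(hg2.toLp : Lp ℂ 2 volume)‖ₑ := by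
    rw [← ofReal_norm, Lp.norm_fourier_eq, ofReal_norm]
  rw [h3, h4, Lp_enorm_sq]
  refine le_of_eq (lintegral_congr_ae ?_)
  filter_upwards [hg2.coeFn_toLp] with x hx
  rw [hx]

end Plancherel

/-! ### The function `Φ`: convergence, `L¹` and `L²` bounds -/

section HeatKernel

variable {θ ξ : ℝ}

theorem phiIntegrand_nonneg (θ ξ μ : ℝ) (v : Plane) {t : ℝ} (ht : 0 ≤ t) :
    0 ≤ phiIntegrand θ ξ μ v t := by
  have := Real.sinh_nonneg_iff.2 ht
  unfold phiIntegrand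
  positivity

theorem measurable_phiIntegrand (θ ξ μ : ℝ) :
    Measurable fun p : Plane × ℝ => phiIntegrand θ ξ μ p.1 p.2 := by
  unfold phiIntegrand
  have h1 : Measurable fun p : Plane × ℝ => Real.sinh p.2 :=
    Real.continuous_sinh.measurable.comp measurable_snd
  have h2 : Measurable fun p : Plane × ℝ => Real.cosh p.2 :=
    Real.continuous_cosh.measurable.comp measurable_snd
  fun_prop

theorem measurable_phiIntegrand_right (θ ξ μ : ℝ) (v : Plane) :
    Measurable (phiIntegrand θ ξ μ v) :=
  (measurable_phiIntegrand θ ξ μ).comp measurable_prodMk_left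

theorem half_exp_le_cosh (t : ℝ) : Real.exp t / 2 ≤ Real.cosh t := by
  rw [Real.cosh_eq]
  have := Real.exp_pos (-t)
  linarith

/-- Since `exp(-s) ≤ 1/s`, the factor `exp(-c coth t)` is at most `tanh t / c`. This cancels the
singularity of `1 / sinh t` at `0` and leaves `1 / cosh t ≤ 2 exp(-t)`. -/
theorem phiIntegrand_integrableOn (hθ : 0 < θ) (hξ : 0 < ξ) (μ : ℝ) {v : Plane} (hv : v ≠ 0) :
    IntegrableOn (phiIntegrand θ ξ μ v) (Ioi 0) := by
  set c := ξ / θ * ‖v‖ ^ 2 with hc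
  have hc0 : 0 < c := by have := norm_pos_iff.2 hv; positivity
  have hg : IntegrableOn (fun t : ℝ => 1 / (c * Real.pi) * Real.exp (-1 * t)) (Ioi 0) :=
    (integrableOn_exp_mul_Ioi (by norm_num) 0).const_mul _
  refine hg.mono' (measurable_phiIntegrand_right θ ξ μ v).aestronglyMeasurable ?_
  filter_upwards [ae_restrict_mem measurableSet_Ioi] with t ht
  have ht : 0 < t := ht
  have hs : 0 < Real.sinh t := Real.sinh_pos_iff.2 ht
  have hch : 0 < Real.cosh t := Real.cosh_pos t
  rw [Real.norm_of_nonneg (phiIntegrand_nonneg θ ξ μ v ht.le), phiIntegrand, ← hc]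
  have h1 : Real.exp (-(t * (θ * μ ^ 2 / (4 * ξ)))) ≤ 1 :=
    Real.exp_le_one_iff.2 (by have : 0 ≤ t * (θ * μ ^ 2 / (4 * ξ)) := by positivity
                              linarith)
  have h2 : Real.exp (-(c * (Real.cosh t / Real.sinh t))) ≤
      1 / (c * (Real.cosh t / Real.sinh t)) := by
    rw [Real.exp_neg, ← one_div]
    refine one_div_le_one_div_of_le (by positivity) ?_
    have := Real.add_one_le_exp (c * (Real.cosh t / Real.sinh t))
    linarith
  have h3 : 1 / Real.cosh t ≤ 2 * Real.exp (-1 * t) := by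
    rw [neg_one_mul, Real.exp_neg, ← div_eq_mul_inv, div_le_div_iff₀ hch (Real.exp_pos t)]
    linarith [half_exp_le_cosh t]
  calc _ ≤ 1 / (4 * Real.pi * Real.sinh t) * (1 / (c * (Real.cosh t / Real.sinh t))) := by
        gcongr
    _ = 1 / (4 * c * Real.pi) * (1 / Real.cosh t) := by field_simp
    _ ≤ 1 / (4 * c * Real.pi) * (2 * Real.exp (-1 * t)) := by gcongr
    _ = 1 / 2 * (1 / (c * Real.pi) * Real.exp (-1 * t)) := by field_simp; ring
    _ ≤ _ := by
      have : 0 ≤ 1 / (c * Real.pi) * Real.exp (-1 * t) := by positivity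
      linarith

theorem measurable_Phi (θ ξ μ : ℝ) : Measurable (Phi θ ξ μ) :=
  ((measurable_phiIntegrand θ ξ μ).stronglyMeasurable.integral_prod_right'
    (ν := volume.restrict (Ioi 0))).measurable

theorem enorm_Phi_le (θ ξ μ : ℝ) (v : Plane) :
    ‖Phi θ ξ μ v‖ₑ ≤ ∫⁻ t in Ioi 0, ENNReal.ofReal (phiIntegrand θ ξ μ v t) := by
  refine (enorm_integral_le_lintegral_enorm _).trans (le_of_eq ?_)
  refine setLIntegral_congr_fun measurableSet_Ioi fun t ht => ?_
  rw [Real.enorm_of_nonneg (phiIntegrand_nonneg θ ξ μ v (le_of_lt ht))]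

/-- The Gaussian integral on the plane. -/
theorem integral_exp_neg_mul_sq {b : ℝ} (hb : 0 < b) :
    ∫ v : Plane, Real.exp (-(b * ‖v‖ ^ 2)) = Real.pi / b := by
  have := GaussianFourier.integral_rexp_neg_mul_sq_norm (V := Plane) hb
  simpa using this

theorem integrable_exp_neg_mul_sq {b : ℝ} (hb : 0 < b) :
    Integrable fun v : Plane => Real.exp (-(b * ‖v‖ ^ 2)) := by
  refine Integrable.of_integral_ne_zero ?_
  rw [integral_exp_neg_mul_sq hb]
  positivity

theorem lintegral_exp_neg_mul_sq {b : ℝ} (hb : 0 < b) :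
    ∫⁻ v : Plane, ENNReal.ofReal (Real.exp (-(b * ‖v‖ ^ 2))) = ENNReal.ofReal (Real.pi / b) := by
  rw [← integral_exp_neg_mul_sq hb, ofReal_integral_eq_lintegral_ofReal
    (integrable_exp_neg_mul_sq hb) (ae_of_all _ fun v => (Real.exp_pos _).le)]

theorem lintegral_exp_neg_mul_Ioi {a : ℝ} (ha : 0 < a) :
    ∫⁻ t in Ioi (0 : ℝ), ENNReal.ofReal (Real.exp (-a * t)) = ENNReal.ofReal (1 / a) := by
  have h := integral_exp_mul_Ioi (neg_neg_of_pos ha) 0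
  rw [← ofReal_integral_eq_lintegral_ofReal (integrableOn_exp_mul_Ioi (neg_neg_of_pos ha) 0)
    (ae_of_all _ fun v => (Real.exp_pos _).le), h]
  simp

/-- By Tonelli, integrate the Gaussian in `v` first: its mass `π θ tanh t / ξ` again turns `1 / sinh
t` into `1 / cosh t`. -/
theorem lintegral_Phi_lt_top (hθ : 0 < θ) (hξ : 0 < ξ) (μ : ℝ) :
    ∫⁻ v, ‖Phi θ ξ μ v‖ₑ < ∞ := by
  have hm : Measurable fun p : Plane × ℝ => ENNReal.ofReal (phiIntegrand θ ξ μ p.1 p.2) :=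
    (measurable_phiIntegrand θ ξ μ).ennreal_ofReal
  calc ∫⁻ v, ‖Phi θ ξ μ v‖ₑ
      ≤ ∫⁻ v, ∫⁻ t in Ioi 0, ENNReal.ofReal (phiIntegrand θ ξ μ v t) :=
        lintegral_mono fun v => enorm_Phi_le θ ξ μ v
    _ = ∫⁻ t in Ioi 0, ∫⁻ v, ENNReal.ofReal (phiIntegrand θ ξ μ v t) :=
        lintegral_lintegral_swap hm.aemeasurable
    _ ≤ ∫⁻ t in Ioi (0 : ℝ), ENNReal.ofReal (θ / (2 * ξ)) *
          ENNReal.ofReal (Real.exp (-1 * t)) := by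
        refine setLIntegral_mono' measurableSet_Ioi fun t ht => ?_
        have ht : 0 < t := ht
        have hs : 0 < Real.sinh t := Real.sinh_pos_iff.2 ht
        have hch : 0 < Real.cosh t := Real.cosh_pos t
        have h1 : Real.exp (-(t * (θ * μ ^ 2 / (4 * ξ)))) ≤ 1 :=
          Real.exp_le_one_iff.2 (by have : 0 ≤ t * (θ * μ ^ 2 / (4 * ξ)) := by positivity
                                    linarith)
        have h3 : 1 / Real.cosh t ≤ 2 * Real.exp (-1 * t) := by
          rw [neg_one_mul, Real.exp_neg, ← div_eq_mul_inv, div_le_div_iff₀ hch (Real.exp_pos t)]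
          linarith [half_exp_le_cosh t]
        have hb : 0 < ξ / θ * (Real.cosh t / Real.sinh t) := by positivity
        have e : ∀ v : Plane, ξ / θ * ‖v‖ ^ 2 * (Real.cosh t / Real.sinh t)
            = ξ / θ * (Real.cosh t / Real.sinh t) * ‖v‖ ^ 2 := fun v => by ring
        simp only [phiIntegrand, e]
        have hpos : 0 ≤ Real.exp (-(t * (θ * μ ^ 2 / (4 * ξ)))) / (4 * Real.pi * Real.sinh t) := by
          positivity
        simp only [ENNReal.ofReal_mul hpos]
        rw [lintegral_const_mul' _ _ (by simp), lintegral_exp_neg_mul_sq hb,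
          ← ENNReal.ofReal_mul hpos, ← ENNReal.ofReal_mul (by positivity)]
        refine ENNReal.ofReal_le_ofReal ?_
        calc _ ≤ 1 / (4 * Real.pi * Real.sinh t) *
              (Real.pi / (ξ / θ * (Real.cosh t / Real.sinh t))) := by gcongr
          _ = θ / (4 * ξ) * (1 / Real.cosh t) := by field_simp
          _ ≤ θ / (4 * ξ) * (2 * Real.exp (-1 * t)) := by gcongr
          _ = _ := by field_simp; ring
    _ < ∞ := by
        rw [lintegral_const_mul' _ _ (by simp), lintegral_exp_neg_mul_Ioi one_pos]
        exact ENNReal.mul_lt_top (by simp) (by simp)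

/-- The even terms contribute a quarter of `ζ(2) = π²/6`, leaving three quarters for the odd ones.
-/
theorem hasSum_one_div_odd_sq :
    HasSum (fun k : ℕ => 1 / (2 * (k : ℝ) + 1) ^ 2) (Real.pi ^ 2 / 8) := by
  have h := hasSum_zeta_two
  have he : HasSum (fun k : ℕ => 1 / ((2 * k : ℕ) : ℝ) ^ 2) (1 / 4 * (Real.pi ^ 2 / 6)) := by
    refine (funext fun k => ?_ : (fun k : ℕ => 1 / 4 * (1 / (k : ℝ) ^ 2)) =
      fun k : ℕ => 1 / ((2 * k : ℕ) : ℝ) ^ 2) ▸ h.mul_left (1 / 4)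
    push_cast
    rw [mul_pow, one_div_mul_one_div]
    norm_num
  have hs : Summable fun k : ℕ => 1 / ((2 * k + 1 : ℕ) : ℝ) ^ 2 :=
    h.summable.comp_injective (i := fun k : ℕ => 2 * k + 1) fun a b hab => by simpa using hab
  have ho := (HasSum.even_add_odd (f := fun n : ℕ => 1 / (n : ℝ) ^ 2) he hs.hasSum).unique h
  have hv : ∑' k : ℕ, 1 / ((2 * k + 1 : ℕ) : ℝ) ^ 2 = Real.pi ^ 2 / 8 := by linarith
  have := hs.hasSum
  rw [hv] at this
  simpa using this

/-- Geometric series for `1 / sinh r = 2 exp(-r) / (1 - exp(-2r))`. -/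
theorem hasSum_inv_sinh {r : ℝ} (hr : 0 < r) :
    HasSum (fun k : ℕ => 2 * Real.exp (-(2 * (k : ℝ) + 1) * r)) (1 / Real.sinh r) := by
  have h := (hasSum_geometric_of_lt_one (Real.exp_pos (-2 * r)).le
    (by rw [Real.exp_lt_one_iff]; linarith)).mul_left (2 * Real.exp (-r))
  have e : 2 * Real.exp (-r) * (1 - Real.exp (-2 * r))⁻¹ = 1 / Real.sinh r := by
    have hs : 0 < Real.sinh r := Real.sinh_pos_iff.2 hr
    have h1 : 1 - Real.exp (-2 * r) = 2 * Real.exp (-r) * Real.sinh r := by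
      rw [Real.sinh_eq, show -2 * r = -r + -r by ring, Real.exp_add]
      have : Real.exp (-r) * Real.exp r = 1 := by rw [← Real.exp_add]; simp
      linear_combination -this
    rw [h1]
    have := Real.exp_pos (-r)
    field_simp
  rw [e] at h
  refine (funext fun k => ?_ : (fun k : ℕ => 2 * Real.exp (-r) * Real.exp (-2 * r) ^ k) =
    fun k : ℕ => 2 * Real.exp (-(2 * (k : ℝ) + 1) * r)) ▸ h
  rw [← Real.exp_nat_mul, mul_assoc, ← Real.exp_add]
  ring_nf

/-- Each term of the exponential series factors into a function of `t` and a function of `s`, so the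
integral is `∑ 2 / (2k + 1)²`. -/
theorem lintegral_inv_sinh_add :
    ∫⁻ t in Ioi (0 : ℝ), ∫⁻ s in Ioi (0 : ℝ), ENNReal.ofReal (1 / Real.sinh (t + s))
      = ENNReal.ofReal (Real.pi ^ 2 / 4) := by
  have h1 : ∀ t ∈ Ioi (0 : ℝ), ∀ s ∈ Ioi (0 : ℝ), ENNReal.ofReal (1 / Real.sinh (t + s))
      = ∑' k : ℕ, ENNReal.ofReal (2 * Real.exp (-(2 * (k : ℝ) + 1) * t)) *
        ENNReal.ofReal (Real.exp (-(2 * (k : ℝ) + 1) * s)) := fun t ht s hs => by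
    have hts : 0 < t + s := add_pos ht hs
    rw [← (hasSum_inv_sinh hts).tsum_eq, ENNReal.ofReal_tsum_of_nonneg (fun k => by positivity)
      (hasSum_inv_sinh hts).summable]
    refine tsum_congr fun k => ?_
    rw [← ENNReal.ofReal_mul (by positivity), mul_assoc, ← Real.exp_add, mul_add]
  have h2 : ∀ k : ℕ, (0 : ℝ) < 2 * k + 1 := fun k => by positivity
  calc _ = ∫⁻ t in Ioi (0 : ℝ), ∑' k : ℕ,
          ENNReal.ofReal (2 * Real.exp (-(2 * (k : ℝ) + 1) * t)) *
            ENNReal.ofReal (1 / (2 * (k : ℝ) + 1)) := by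
        refine setLIntegral_congr_fun measurableSet_Ioi fun t ht => ?_
        rw [setLIntegral_congr_fun measurableSet_Ioi (h1 t ht), lintegral_tsum fun k => by fun_prop]
        refine tsum_congr fun k => ?_
        rw [lintegral_const_mul' _ _ ENNReal.ofReal_ne_top, lintegral_exp_neg_mul_Ioi (h2 k)]
    _ = ∑' k : ℕ, ENNReal.ofReal (2 * (1 / (2 * (k : ℝ) + 1) ^ 2)) := by
        rw [lintegral_tsum fun k => by fun_prop]
        refine tsum_congr fun k => ?_
        have := h2 k
        simp only [ENNReal.ofReal_mul zero_le_two]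
        rw [lintegral_mul_const' _ _ ENNReal.ofReal_ne_top,
          lintegral_const_mul' _ _ ENNReal.ofReal_ne_top,
          lintegral_exp_neg_mul_Ioi (h2 k), mul_assoc, ← ENNReal.ofReal_mul (by positivity)]
        congr 2
        field_simp
    _ = _ := by
        have h := hasSum_one_div_odd_sq.mul_left 2
        rw [← ENNReal.ofReal_tsum_of_nonneg (fun k => by positivity) h.summable, h.tsum_eq]
        congr 1
        ring

/-- The exponents add, and `sinh t sinh s (coth t + coth s) = sinh (t + s)`. The only loss is the
bound of the `μ` exponentials by `1`. -/
theorem lintegral_phiIntegrand_mul_le (hθ : 0 < θ) (hξ : 0 < ξ) (μ : ℝ) {t s : ℝ} (ht : 0 < t)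
    (hs : 0 < s) :
    ∫⁻ v, ENNReal.ofReal (phiIntegrand θ ξ μ v t) * ENNReal.ofReal (phiIntegrand θ ξ μ v s)
      ≤ ENNReal.ofReal (θ / (16 * Real.pi * ξ)) * ENNReal.ofReal (1 / Real.sinh (t + s)) := by
  have hst : 0 < Real.sinh t := Real.sinh_pos_iff.2 ht
  have hss : 0 < Real.sinh s := Real.sinh_pos_iff.2 hs
  have hct : 0 < Real.cosh t := Real.cosh_pos t
  have hcs : 0 < Real.cosh s := Real.cosh_pos s
  have hE : ∀ t, 0 < t → Real.exp (-(t * (θ * μ ^ 2 / (4 * ξ)))) ≤ 1 := fun t ht =>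
    Real.exp_le_one_iff.2 (by have : 0 ≤ t * (θ * μ ^ 2 / (4 * ξ)) := by positivity
                              linarith)
  set b := ξ / θ * (Real.cosh t / Real.sinh t + Real.cosh s / Real.sinh s) with hb
  have hb0 : 0 < b := by positivity
  calc _ ≤ ∫⁻ v : Plane, ENNReal.ofReal (1 / (16 * Real.pi ^ 2 * Real.sinh t * Real.sinh s)) *
        ENNReal.ofReal (Real.exp (-(b * ‖v‖ ^ 2))) := by
        refine lintegral_mono fun v => ?_
        rw [← ENNReal.ofReal_mul (phiIntegrand_nonneg θ ξ μ v ht.le),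
          ← ENNReal.ofReal_mul (by positivity)]
        refine ENNReal.ofReal_le_ofReal ?_
        rw [phiIntegrand, phiIntegrand]
        have e : Real.exp (-(b * ‖v‖ ^ 2)) =
            Real.exp (-(ξ / θ * ‖v‖ ^ 2 * (Real.cosh t / Real.sinh t))) *
            Real.exp (-(ξ / θ * ‖v‖ ^ 2 * (Real.cosh s / Real.sinh s))) := by
          rw [← Real.exp_add, hb]
          ring_nf
        rw [e]
        calc _ ≤ 1 / (4 * Real.pi * Real.sinh t) *
              Real.exp (-(ξ / θ * ‖v‖ ^ 2 * (Real.cosh t / Real.sinh t))) *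
              (1 / (4 * Real.pi * Real.sinh s) *
              Real.exp (-(ξ / θ * ‖v‖ ^ 2 * (Real.cosh s / Real.sinh s)))) := by
              gcongr
              · exact hE t ht
              · exact hE s hs
          _ = _ := by field_simp; ring
    _ = _ := by
        rw [lintegral_const_mul' _ _ (by simp), lintegral_exp_neg_mul_sq hb0,
          ← ENNReal.ofReal_mul (by positivity), ← ENNReal.ofReal_mul (by positivity)]
        congr 1
        rw [hb, Real.sinh_add]
        field_simp
        ring

/-- The square of the `t` integral is a double integral over `(t, s)`; integrating over `v` first
makes it computable, as `θ/(16πξ) · π²/4`. -/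
theorem lintegral_Phi_sq_le (hθ : 0 < θ) (hξ : 0 < ξ) (μ : ℝ) :
    ∫⁻ v, ‖Phi θ ξ μ v‖ₑ ^ 2 ≤ ENNReal.ofReal (Real.pi * θ / (64 * ξ)) := by
  have hm : Measurable fun p : Plane × ℝ => ENNReal.ofReal (phiIntegrand θ ξ μ p.1 p.2) :=
    (measurable_phiIntegrand θ ξ μ).ennreal_ofReal
  have hmt : ∀ v, Measurable fun t : ℝ => ENNReal.ofReal (phiIntegrand θ ξ μ v t) := fun v =>
    hm.comp measurable_prodMk_left
  have hmv : ∀ t, Measurable fun v : Plane => ENNReal.ofReal (phiIntegrand θ ξ μ v t) := fun t =>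
    hm.comp measurable_prodMk_right
  have hm' : Measurable fun p : Plane × ℝ => ∫⁻ s in Ioi 0,
      ENNReal.ofReal (phiIntegrand θ ξ μ p.1 p.2) * ENNReal.ofReal (phiIntegrand θ ξ μ p.1 s) :=
    Measurable.lintegral_prod_right' (f := fun q : (Plane × ℝ) × ℝ =>
      ENNReal.ofReal (phiIntegrand θ ξ μ q.1.1 q.1.2) * ENNReal.ofReal (phiIntegrand θ ξ μ q.1.1 q.2))
      ((hm.comp measurable_fst).mul (hm.comp (by fun_prop : Measurable fun q : (Plane × ℝ) × ℝ =>
        (q.1.1, q.2))))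
  calc ∫⁻ v, ‖Phi θ ξ μ v‖ₑ ^ 2
      ≤ ∫⁻ v, (∫⁻ t in Ioi 0, ENNReal.ofReal (phiIntegrand θ ξ μ v t)) ^ 2 :=
        lintegral_mono fun v => pow_le_pow_left₀ zero_le (enorm_Phi_le θ ξ μ v) 2
    _ = ∫⁻ v, ∫⁻ t in Ioi 0, ∫⁻ s in Ioi 0, ENNReal.ofReal (phiIntegrand θ ξ μ v t) *
          ENNReal.ofReal (phiIntegrand θ ξ μ v s) := by
        refine lintegral_congr fun v => ?_
        rw [sq, ← lintegral_mul_const _ (hmt v)]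
        refine lintegral_congr fun t => ?_
        rw [lintegral_const_mul _ (hmt v)]
    _ = ∫⁻ t in Ioi 0, ∫⁻ s in Ioi 0, ∫⁻ v, ENNReal.ofReal (phiIntegrand θ ξ μ v t) *
          ENNReal.ofReal (phiIntegrand θ ξ μ v s) := by
        refine (lintegral_lintegral_swap (f := fun v t => ∫⁻ s in Ioi 0,
          ENNReal.ofReal (phiIntegrand θ ξ μ v t) * ENNReal.ofReal (phiIntegrand θ ξ μ v s))
          hm'.aemeasurable).trans ?_
        refine lintegral_congr fun t => ?_
        refine lintegral_lintegral_swap (f := fun v s =>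
          ENNReal.ofReal (phiIntegrand θ ξ μ v t) * ENNReal.ofReal (phiIntegrand θ ξ μ v s)) (Measurable.aemeasurable ?_)
        exact ((hmv t).comp measurable_fst).mul hm
    _ ≤ ∫⁻ t in Ioi 0, ∫⁻ s in Ioi 0, ENNReal.ofReal (θ / (16 * Real.pi * ξ)) *
          ENNReal.ofReal (1 / Real.sinh (t + s)) := by
        refine setLIntegral_mono' measurableSet_Ioi fun t ht => ?_
        refine setLIntegral_mono' measurableSet_Ioi fun s hs => ?_
        exact lintegral_phiIntegrand_mul_le hθ hξ μ ht hs
    _ = _ := by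
        simp only [lintegral_const_mul' _ _ ENNReal.ofReal_ne_top]
        rw [lintegral_inv_sinh_add, ← ENNReal.ofReal_mul (by positivity)]
        congr 1
        field_simp
        ring

theorem integrable_Phi (hθ : 0 < θ) (hξ : 0 < ξ) (μ : ℝ) : Integrable (Phi θ ξ μ) :=
  ⟨(measurable_Phi θ ξ μ).aestronglyMeasurable, lintegral_Phi_lt_top hθ hξ μ⟩

end HeatKernel

/-! ### Magnetic Gaussians as Schwartz functions, and the Landau operator on them -/

section SchwartzExp

variable {E : Type*} [NormedAddCommGroup E] [NormedSpace ℝ E]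

/-- The real iterated derivative is the complex one with restricted scalars, and every complex
derivative of `exp` is `exp`. -/
theorem norm_iteratedFDeriv_cexp (n : ℕ) (z : ℂ) :
    ‖iteratedFDeriv ℝ n Complex.exp z‖ = ‖Complex.exp z‖ := by
  have h : ContDiffAt ℂ n Complex.exp z := Complex.contDiff_exp.contDiffAt
  have h1 := h.restrictScalars_iteratedFDeriv (𝕜 := ℝ)
  rw [← h1]
  simp only [Function.comp_apply]
  rw [ContinuousMultilinearMap.norm_restrictScalars, norm_iteratedFDeriv_eq_norm_iteratedDeriv,
    iteratedDeriv_eq_iterate, Complex.iter_deriv_exp]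

/-- The exponential of a function of temperate growth is a Schwartz function if it decays
rapidly. -/
def expSchwartz (q : E → ℂ) (hq : q.HasTemperateGrowth)
    (h : ∀ k : ℕ, ∃ C : ℝ, ∀ x, (1 + ‖x‖) ^ k * ‖Complex.exp (q x)‖ ≤ C) : 𝓢(E, ℂ) where
  toFun x := Complex.exp (q x)
  smooth' := Complex.contDiff_exp.comp hq.1
  decay' k n := by
    obtain ⟨m, C, hC, hb⟩ := hq.norm_iteratedFDeriv_le_uniform n
    -- The chain rule bound for the `n`-th derivative costs the `n`-th power of a polynomial of
    -- degree `m` in `1 + ‖x‖`, on top of the weight of degree `k`.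
    obtain ⟨C', hC'⟩ := h (k + m * n)
    refine ⟨n.factorial * (1 + C) ^ n * C', fun x => ?_⟩
    have h1 : (1 : ℝ) ≤ (1 + ‖x‖) ^ m := one_le_pow₀ (by simp)
    -- The bound for the composition needs `D ^ i` at order `i`; taking `1 + C` in place of `C`
    -- ensures `D ≥ 1`, hence `D ≤ D ^ i`.
    have hD : (1 : ℝ) ≤ (1 + C) * (1 + ‖x‖) ^ m := by nlinarith
    have h2 := norm_iteratedFDeriv_comp_le (𝕜 := ℝ) (n := n) (N := n) (g := Complex.exp) (f := q)
      Complex.contDiff_exp (hq.1.of_le (by exact_mod_cast le_top)) le_rfl x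
      (C := ‖Complex.exp (q x)‖) (D := (1 + C) * (1 + ‖x‖) ^ m)
      (fun i _ => (norm_iteratedFDeriv_cexp i _).le) fun i hi hin =>
        ((hb i hin x).trans (by nlinarith [pow_nonneg (by positivity : (0 : ℝ) ≤ 1 + ‖x‖) m])).trans
          (le_self_pow₀ hD (by omega))
    calc ‖x‖ ^ k * ‖iteratedFDeriv ℝ n (fun x => Complex.exp (q x)) x‖
        ≤ (1 + ‖x‖) ^ k *
          (n.factorial * ‖Complex.exp (q x)‖ * ((1 + C) * (1 + ‖x‖) ^ m) ^ n) := by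
          refine mul_le_mul ?_ h2 (norm_nonneg _) (by positivity)
          gcongr
          simp
      _ = n.factorial * (1 + C) ^ n * ((1 + ‖x‖) ^ (k + m * n) * ‖Complex.exp (q x)‖) := by
          rw [mul_pow, pow_add, pow_mul]
          ring
      _ ≤ _ := by
          gcongr
          exact hC' x

/-- A power is absorbed by an exponential, `(1 + r)^k ≤ k! exp(1 + r)`, and completing the square
gives `r - b r² ≤ 1/(4b)`. -/
theorem one_add_pow_mul_exp_neg_le (k : ℕ) {b : ℝ} (hb : 0 < b) {r : ℝ} (hr : 0 ≤ r) :
    (1 + r) ^ k * Real.exp (-(b * r ^ 2)) ≤ k.factorial * Real.exp (1 + 1 / (4 * b)) := by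
  have h1 : (1 + r) ^ k ≤ k.factorial * Real.exp (1 + r) := by
    have := Real.pow_div_factorial_le_exp (1 + r) (by positivity) k
    rwa [div_le_iff₀' (by positivity)] at this
  calc _ ≤ k.factorial * Real.exp (1 + r) * Real.exp (-(b * r ^ 2)) := by gcongr
    _ = k.factorial * Real.exp (1 + r - b * r ^ 2) := by
      rw [mul_assoc, ← Real.exp_add, sub_eq_add_neg]
    _ ≤ _ := by
      gcongr
      have : 0 ≤ b * (r - 1 / (2 * b)) ^ 2 := by positivity
      have e : b * (r - 1 / (2 * b)) ^ 2 = b * r ^ 2 - r + 1 / (4 * b) := by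
        field_simp
        ring
      linarith

end SchwartzExp

/-- The linear form `y ↦ x Θ⁻¹ y`. -/
def thetaCLM (θ : ℝ) (x : Plane) : Plane →L[ℝ] ℝ :=
  (x 1 / θ) • EuclideanSpace.proj 0 - (x 0 / θ) • EuclideanSpace.proj 1

@[simp]
theorem thetaCLM_apply (θ : ℝ) (x y : Plane) : thetaCLM θ x y = thetaForm θ x y := by
  simp [thetaCLM, thetaForm]
  ring

/-- The exponent of a magnetic Gaussian. -/
def gaussExponent (θ ξ b : ℝ) (x y : Plane) : ℂ :=
  2 * Complex.I * ξ * (thetaForm θ x y : ℝ) - (b * ‖x - y‖ ^ 2 : ℝ)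

theorem gaussExponent_hasTemperateGrowth (θ ξ b : ℝ) (x : Plane) :
    (gaussExponent θ ξ b x).HasTemperateGrowth := by
  have h1 : (fun y : Plane => (thetaForm θ x y : ℂ)).HasTemperateGrowth := by
    have := Complex.ofRealCLM.hasTemperateGrowth.comp (thetaCLM θ x).hasTemperateGrowth
    simpa [Function.comp_def] using this
  have h2 : (fun y : Plane => ((‖x - y‖ ^ 2 : ℝ) : ℂ)).HasTemperateGrowth :=
    Complex.ofRealCLM.hasTemperateGrowth.comp ((Function.hasTemperateGrowth_norm_sq Plane).comp
      ((Function.HasTemperateGrowth.const x).sub Function.HasTemperateGrowth.id'))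
  have h3 := ((Function.HasTemperateGrowth.const (2 * Complex.I * ξ)).mul h1).sub
    ((Function.HasTemperateGrowth.const (b : ℂ)).mul h2)
  have e : gaussExponent θ ξ b x = fun y => 2 * Complex.I * ξ * (thetaForm θ x y : ℂ) -
      (b : ℂ) * ((‖x - y‖ ^ 2 : ℝ) : ℂ) := funext fun y => by simp [gaussExponent]
  rw [e]
  exact h3

theorem norm_cexp_gaussExponent (θ ξ b : ℝ) (x y : Plane) :
    ‖Complex.exp (gaussExponent θ ξ b x y)‖ = Real.exp (-(b * ‖x - y‖ ^ 2)) := by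
  rw [Complex.norm_exp, gaussExponent]
  congr 1
  rw [Complex.sub_re, Complex.ofReal_re]
  simp [-thetaCLM_apply]

/-- The magnetic Gaussian `y ↦ exp(2iξ x Θ⁻¹ y - b |x - y|²)` as a Schwartz function. -/
def magGauss (θ ξ : ℝ) {b : ℝ} (hb : 0 < b) (x : Plane) : 𝓢(Plane, ℂ) :=
  expSchwartz (gaussExponent θ ξ b x) (gaussExponent_hasTemperateGrowth θ ξ b x) fun k => by
    refine ⟨(1 + ‖x‖) ^ k * (k.factorial * Real.exp (1 + 1 / (4 * b))), fun y => ?_⟩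
    rw [norm_cexp_gaussExponent]
    have h1 : 1 + ‖y‖ ≤ (1 + ‖x‖) * (1 + ‖x - y‖) := by
      have h2 : ‖y‖ ≤ ‖x‖ + ‖x - y‖ := by
        have := norm_sub_le x (x - y)
        rwa [sub_sub_cancel] at this
      nlinarith [norm_nonneg x, norm_nonneg (x - y)]
    calc _ ≤ ((1 + ‖x‖) * (1 + ‖x - y‖)) ^ k * Real.exp (-(b * ‖x - y‖ ^ 2)) := by gcongr
      _ = (1 + ‖x‖) ^ k * ((1 + ‖x - y‖) ^ k * Real.exp (-(b * ‖x - y‖ ^ 2))) := by rw [mul_pow, mul_assoc]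
      _ ≤ _ := mul_le_mul_of_nonneg_left (one_add_pow_mul_exp_neg_le k hb (norm_nonneg _))
        (by positivity)

theorem magGauss_apply (θ ξ : ℝ) {b : ℝ} (hb : 0 < b) (x y : Plane) :
    magGauss θ ξ hb x y = Complex.exp (gaussExponent θ ξ b x y) := rfl

/-- The logarithmic derivative of the magnetic Gaussian. -/
def gaussLogDeriv (θ ξ b : ℝ) (x : Plane) (i : Fin 2) (y : Plane) : ℂ :=
  2 * Complex.I * ξ * (thetaForm θ x (EuclideanSpace.single i 1) : ℝ) + 2 * b * (x i - y i : ℝ)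

theorem norm_sub_add_smul_single_sq (x y : Plane) (i : Fin 2) (t : ℝ) :
    ‖x - (y + t • EuclideanSpace.single i (1 : ℝ))‖ ^ 2
      = ‖x - y‖ ^ 2 - 2 * t * (x i - y i) + t ^ 2 := by
  rw [EuclideanSpace.real_norm_sq_eq, EuclideanSpace.real_norm_sq_eq, Fin.sum_univ_two,
    Fin.sum_univ_two]
  fin_cases i <;> simp <;> ring

theorem hasDerivAt_gaussExponent (θ ξ b : ℝ) (x y : Plane) (i : Fin 2) :
    HasDerivAt (fun t : ℝ => gaussExponent θ ξ b x (y + t • EuclideanSpace.single i (1 : ℝ)))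
      (gaussLogDeriv θ ξ b x i y) 0 := by
  have e : (fun t : ℝ => gaussExponent θ ξ b x (y + t • EuclideanSpace.single i (1 : ℝ))) =
      fun t : ℝ => 2 * Complex.I * ξ * ((thetaForm θ x y + t * thetaForm θ x
        (EuclideanSpace.single i 1) : ℝ) : ℂ) -
        ((b * (‖x - y‖ ^ 2 - 2 * t * (x i - y i) + t ^ 2) : ℝ) : ℂ) := by
    funext t
    rw [gaussExponent, norm_sub_add_smul_single_sq, ← thetaCLM_apply, map_add, map_smul]
    simp
  rw [e]
  have h1 : HasDerivAt (fun t : ℝ => thetaForm θ x y + t * thetaForm θ x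
      (EuclideanSpace.single i 1)) (1 * thetaForm θ x (EuclideanSpace.single i 1)) 0 :=
    ((hasDerivAt_id (0 : ℝ)).mul_const _).const_add _
  have h2 : HasDerivAt (fun t : ℝ => b * (‖x - y‖ ^ 2 - 2 * t * (x i - y i) + t ^ 2))
      (b * (-(2 * 1 * (x i - y i)) + 2 * 0)) 0 := by
    have := (((((hasDerivAt_id (0 : ℝ)).const_mul 2).mul_const (x i - y i)).const_sub
      (‖x - y‖ ^ 2)).add (hasDerivAt_pow 2 (0 : ℝ))).const_mul b
    simpa using this
  refine ((h1.ofReal_comp.const_mul (2 * Complex.I * ξ)).sub h2.ofReal_comp).congr_deriv ?_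
  rw [gaussLogDeriv]
  push_cast
  ring

theorem partialD_magGauss (θ ξ : ℝ) {b : ℝ} (hb : 0 < b) (x : Plane) (i : Fin 2) (y : Plane) :
    partialD i (magGauss θ ξ hb x) y = gaussLogDeriv θ ξ b x i y * magGauss θ ξ hb x y := by
  rw [partialD_apply]
  refine HasLineDerivAt.lineDeriv (f := magGauss θ ξ hb x) ?_
  have h := (hasDerivAt_gaussExponent θ ξ b x y i).cexp
  rw [mul_comm]
  simpa [HasLineDerivAt, magGauss_apply] using h

theorem partialD_partialD_magGauss (θ ξ : ℝ) {b : ℝ} (hb : 0 < b) (x : Plane) (i : Fin 2)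
    (y : Plane) : partialD i (partialD i (magGauss θ ξ hb x)) y =
      (gaussLogDeriv θ ξ b x i y ^ 2 - 2 * b) * magGauss θ ξ hb x y := by
  have e : (partialD i (magGauss θ ξ hb x) : Plane → ℂ) = fun y =>
      gaussLogDeriv θ ξ b x i y * Complex.exp (gaussExponent θ ξ b x y) :=
    funext fun y => partialD_magGauss θ ξ hb x i y
  rw [partialD_apply, e]
  refine HasLineDerivAt.lineDeriv ?_
  have h1 : HasDerivAt (fun t : ℝ => gaussLogDeriv θ ξ b x i
      (y + t • EuclideanSpace.single i (1 : ℝ))) (-(2 * b)) 0 := by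
    have e1 : (fun t : ℝ => gaussLogDeriv θ ξ b x i (y + t • EuclideanSpace.single i (1 : ℝ)))
        = fun t : ℝ => gaussLogDeriv θ ξ b x i y - 2 * b * (t : ℂ) := by
      funext t
      simp [gaussLogDeriv]
      ring
    rw [e1]
    simpa using ((Complex.ofRealCLM.hasDerivAt (x := 0)).const_mul (2 * b : ℂ)).const_sub
      (gaussLogDeriv θ ξ b x i y)
  have h2 := h1.mul (hasDerivAt_gaussExponent θ ξ b x y i).cexp
  simp only [zero_smul, add_zero] at h2
  rw [HasLineDerivAt]
  refine h2.congr_deriv ?_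
  rw [magGauss_apply]
  ring

theorem landauSchwartz_apply (θ ξ : ℝ) (f : 𝓢(Plane, ℂ)) (y : Plane) :
    landauSchwartz θ ξ f y = ∑ i : Fin 2, (-partialD i (partialD i f) y
      + (ξ : ℂ) ^ 2 * ((xTilde θ i y : ℂ) * ((xTilde θ i y : ℂ) * f y))
      - 2 * Complex.I * ξ * ((xTilde θ i y : ℂ) * partialD i f y)) := by
  simp only [landauSchwartz, Fin.sum_univ_two]
  simp [mulTilde_apply]

/-- The phase makes `∂_i + iξ x̃_i` act as multiplication by `2b v_i - 2iξ Θ⁻¹_{ij} v_j` with `v = x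
- y`. In the sum of squares the cross terms vanish by antisymmetry of `Θ⁻¹`, and differentiating the
multiplier adds `4b`. -/
theorem landauSchwartz_magGauss {θ : ℝ} (hθ : θ ≠ 0) (ξ : ℝ) {b : ℝ} (hb : 0 < b) (x y : Plane) :
    landauSchwartz θ ξ (magGauss θ ξ hb x) y =
      ((4 * b + 4 * ((ξ / θ) ^ 2 - b ^ 2) * ‖x - y‖ ^ 2 : ℝ) : ℂ) * magGauss θ ξ hb x y := by
  rw [landauSchwartz_apply]
  simp only [partialD_magGauss, partialD_partialD_magGauss, Fin.sum_univ_two,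
    EuclideanSpace.real_norm_sq_eq]
  simp only [gaussLogDeriv, xTilde, thetaForm]
  simp
  have hθ' : (θ : ℂ) ≠ 0 := by exact_mod_cast hθ
  field_simp
  ring_nf
  simp only [Complex.I_sq]
  ring

/-! ### Symmetry of the Landau operator -/

section Symmetric

theorem inner_toL2 (f g : 𝓢(Plane, ℂ)) :
    inner ℂ (toL2 f) (toL2 g) = ∫ x, starRingEnd ℂ (f x) * g x := by
  refine (SchwartzMap.inner_toL2_toL2_eq f g).trans ?_
  simp only [RCLike.inner_apply, mul_comm]

theorem inner_toL2_left (f : 𝓢(Plane, ℂ)) (h : L2Plane) :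
    inner ℂ (toL2 f) h = ∫ x, starRingEnd ℂ (f x) * h x := by
  rw [L2.inner_def]
  refine integral_congr_ae ?_
  filter_upwards [f.coeFn_toLp 2 volume] with x hx
  have hx' : (toL2 f : Plane → ℂ) x = f x := hx
  rw [hx', RCLike.inner_apply, mul_comm]

theorem inner_toL2_partialD (i : Fin 2) (f g : 𝓢(Plane, ℂ)) :
    inner ℂ (toL2 (partialD i f)) (toL2 g) = -inner ℂ (toL2 f) (toL2 (partialD i g)) := by
  rw [inner_toL2, inner_toL2]
  have h := SchwartzMap.integral_bilinear_lineDerivOp_right_eq_neg_left (μ := volume) f g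
    ((ContinuousLinearMap.mul ℝ ℂ).comp (Complex.conjCLE : ℂ →L[ℝ] ℂ))
    (EuclideanSpace.single i (1 : ℝ))
  exact (neg_eq_iff_eq_neg.2 h).symm

theorem inner_toL2_mulTilde (θ : ℝ) (i : Fin 2) (f g : 𝓢(Plane, ℂ)) :
    inner ℂ (toL2 (mulTilde θ i f)) (toL2 g) = inner ℂ (toL2 f) (toL2 (mulTilde θ i g)) := by
  rw [inner_toL2, inner_toL2]
  refine integral_congr_ae (ae_of_all _ fun x => ?_)
  simp only [mulTilde_apply, map_mul, Complex.conj_ofReal]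
  ring

/-- `x̃_i` does not involve the coordinate `x_i`, so no commutator term spoils the symmetry of the
first order part. -/
theorem partialD_mulTilde (θ : ℝ) (i : Fin 2) (f : 𝓢(Plane, ℂ)) :
    partialD i (mulTilde θ i f) = mulTilde θ i (partialD i f) := by
  ext y
  rw [partialD_apply, mulTilde_apply, partialD_apply]
  have e : (mulTilde θ i f : Plane → ℂ) = fun y => (xTilde θ i y : ℂ) * f y :=
    funext fun y => mulTilde_apply θ i f y
  rw [e]
  have hx : ∀ t : ℝ, xTilde θ i (y + t • EuclideanSpace.single i (1 : ℝ)) = xTilde θ i y := by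
    intro t
    fin_cases i <;> simp [xTilde]
  simp only [lineDeriv, hx]
  rw [deriv_const_mul_field]

theorem landauSchwartz_eq (θ ξ : ℝ) (f : 𝓢(Plane, ℂ)) :
    landauSchwartz θ ξ f = ∑ i : Fin 2, (-partialD i (partialD i f)
      + ((ξ : ℂ) ^ 2) • mulTilde θ i (mulTilde θ i f)
      - (2 * Complex.I * (ξ : ℂ)) • mulTilde θ i (partialD i f)) := by
  simp [landauSchwartz]

/-- The Landau operator is symmetric on Schwartz functions. -/
theorem inner_toL2_landauSchwartz (θ ξ : ℝ) (f g : 𝓢(Plane, ℂ)) :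
    inner ℂ (toL2 (landauSchwartz θ ξ f)) (toL2 g)
      = inner ℂ (toL2 f) (toL2 (landauSchwartz θ ξ g)) := by
  rw [landauSchwartz_eq, landauSchwartz_eq]
  simp only [map_sum, map_sub, map_add, map_neg, map_smul, sum_inner, inner_sum, inner_sub_left,
    inner_sub_right, inner_add_left, inner_add_right, inner_neg_left, inner_neg_right,
    inner_smul_left, inner_smul_right]
  refine Finset.sum_congr rfl fun i _ => ?_
  have h1 : inner ℂ (toL2 (partialD i (partialD i f))) (toL2 g)
      = inner ℂ (toL2 f) (toL2 (partialD i (partialD i g))) := by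
    rw [inner_toL2_partialD, inner_toL2_partialD, neg_neg]
  -- This minus sign cancels the one produced by conjugating the coefficient `2iξ`.
  have h2 : inner ℂ (toL2 (mulTilde θ i (partialD i f))) (toL2 g)
      = -inner ℂ (toL2 f) (toL2 (mulTilde θ i (partialD i g))) := by
    rw [inner_toL2_mulTilde, inner_toL2_partialD, partialD_mulTilde]
  rw [h1, h2, inner_toL2_mulTilde, inner_toL2_mulTilde]
  simp [Complex.conj_ofNat]

end Symmetric

/-! ### Twisted convolution kernels -/

section ConvolutionKernel

theorem norm_cexp_I_mul (r : ℝ) : ‖Complex.exp (Complex.I * r)‖ = 1 := by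
  rw [mul_comm, Complex.norm_exp_ofReal_mul_I]

theorem enorm_cexp_I_mul (r : ℝ) : ‖Complex.exp (Complex.I * r)‖ₑ = 1 := by
  rw [← ofReal_norm, norm_cexp_I_mul, ENNReal.ofReal_one]

/-- A convolution kernel twisted by a phase passes the Schur test. -/
theorem isSchurKernel_conv {k : Plane → ℂ} (hk : Measurable k) (hfin : ∫⁻ v, ‖k v‖ₑ < ∞)
    {r : Plane → Plane → ℝ} (hr : Measurable (Function.uncurry r)) :
    IsSchurKernel volume (fun x y => k (x - y) * Complex.exp (Complex.I * r x y))
      (∫⁻ v, ‖k v‖ₑ).toNNReal := by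
  refine ⟨?_, fun x => ?_, fun y => ?_⟩
  · have h1 : Measurable fun p : Plane × Plane => k (p.1 - p.2) := hk.comp (by fun_prop)
    have h2 : Measurable fun p : Plane × Plane => (r p.1 p.2 : ℂ) :=
      Complex.measurable_ofReal.comp hr
    exact h1.mul (h2.const_mul _).cexp
  · simp only [enorm_mul, enorm_cexp_I_mul, mul_one, ENNReal.coe_toNNReal hfin.ne]
    exact (lintegral_sub_left_eq_self (fun v => ‖k v‖ₑ) x).le
  · simp only [enorm_mul, enorm_cexp_I_mul, mul_one, ENNReal.coe_toNNReal hfin.ne]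
    exact (lintegral_sub_right_eq_self (fun v => ‖k v‖ₑ) y).le

theorem measurable_thetaForm (θ : ℝ) : Measurable fun p : Plane × Plane => thetaForm θ p.1 p.2 := by
  unfold thetaForm
  fun_prop

theorem thetaForm_swap (θ : ℝ) (x y : Plane) : thetaForm θ y x = -thetaForm θ x y := by
  simp only [thetaForm]
  ring

theorem thetaForm_self (θ : ℝ) (x : Plane) : thetaForm θ x x = 0 := by
  simp only [thetaForm]
  ring

end ConvolutionKernel

/-! ### The heat flow: evolution equation and limits in time -/

section HeatFlow

open Filter Topology

variable {θ ξ : ℝ}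

/-- The width parameter of the heat kernel at time `t`. -/
def heatWidth (θ ξ t : ℝ) : ℝ := ξ / θ * (Real.cosh t / Real.sinh t)

/-- The amplitude of the heat kernel at time `t`. -/
def heatAmp (θ ξ μ t : ℝ) : ℝ :=
  Real.exp (-(t * (θ * μ ^ 2 / (4 * ξ)))) / (4 * Real.pi * Real.sinh t)

theorem phiIntegrand_eq (θ ξ μ : ℝ) (v : Plane) (t : ℝ) :
    phiIntegrand θ ξ μ v t = heatAmp θ ξ μ t * Real.exp (-(heatWidth θ ξ t * ‖v‖ ^ 2)) := by
  rw [phiIntegrand, heatAmp, heatWidth]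
  ring_nf

theorem heatWidth_pos (hθ : 0 < θ) (hξ : 0 < ξ) {t : ℝ} (ht : 0 < t) : 0 < heatWidth θ ξ t := by
  have := Real.sinh_pos_iff.2 ht
  have := Real.cosh_pos t
  unfold heatWidth
  positivity

theorem heatAmp_pos (θ ξ μ : ℝ) {t : ℝ} (ht : 0 < t) : 0 < heatAmp θ ξ μ t := by
  have := Real.sinh_pos_iff.2 ht
  unfold heatAmp
  positivity

theorem le_heatWidth (hθ : 0 < θ) (hξ : 0 < ξ) {t : ℝ} (ht : 0 < t) : ξ / θ ≤ heatWidth θ ξ t := by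
  have hs := Real.sinh_pos_iff.2 ht
  refine le_mul_of_one_le_right (by positivity) ((one_le_div hs).2 (Real.sinh_lt_cosh t).le)

/-- The factor by which `-∂_t` acts on the heat kernel, up to a constant. -/
def heatSymbol (θ ξ μ t r : ℝ) : ℝ :=
  4 * heatWidth θ ξ t + 4 * ((ξ / θ) ^ 2 - heatWidth θ ξ t ^ 2) * r ^ 2 + μ ^ 2

/-- The width `b = (ξ/θ) coth t` satisfies `b' = (θ/ξ)((ξ/θ)² - b²)`, and the logarithmic derivative
of `1 / sinh t` is `-(θ/ξ) b`. These match the multiplier of the Landau operator up to the factor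
`-θ/(4ξ)`. -/
theorem hasDerivAt_phiIntegrand (hθ : 0 < θ) (hξ : 0 < ξ) (μ : ℝ) (v : Plane) {t : ℝ}
    (ht : 0 < t) : HasDerivAt (phiIntegrand θ ξ μ v)
      (-(θ / (4 * ξ)) * heatSymbol θ ξ μ t ‖v‖ * phiIntegrand θ ξ μ v t) t := by
  have hs : Real.sinh t ≠ 0 := (Real.sinh_pos_iff.2 ht).ne'
  have h1 : HasDerivAt (fun t => Real.exp (-(t * (θ * μ ^ 2 / (4 * ξ))))) _ t :=
    ((hasDerivAt_id t).mul_const (θ * μ ^ 2 / (4 * ξ))).neg.exp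
  have h2 := h1.div ((Real.hasDerivAt_sinh t).const_mul (4 * Real.pi)) (by positivity)
  have h3 := ((((Real.hasDerivAt_cosh t).div (Real.hasDerivAt_sinh t) hs).const_mul
    (ξ / θ * ‖v‖ ^ 2)).neg.exp)
  refine (h2.mul h3).congr_deriv ?_
  simp only [heatSymbol, heatWidth, phiIntegrand, Pi.neg_apply, Pi.div_apply, id]
  set E1 := Real.exp (-(t * (θ * μ ^ 2 / (4 * ξ))))
  set E2 := Real.exp (-(ξ / θ * ‖v‖ ^ 2 * (Real.cosh t / Real.sinh t)))
  field_simp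
  ring

theorem continuousOn_heatWidth (θ ξ : ℝ) : ContinuousOn (heatWidth θ ξ) (Ioi 0) :=
  continuousOn_const.mul (Real.continuous_cosh.continuousOn.div Real.continuous_sinh.continuousOn
    fun _ ht => (Real.sinh_pos_iff.2 ht).ne')

theorem continuousOn_heatAmp (θ ξ μ : ℝ) : ContinuousOn (heatAmp θ ξ μ) (Ioi 0) := by
  refine ContinuousOn.div (by fun_prop) (Real.continuous_sinh.const_smul (4 * Real.pi)).continuousOn
    fun t ht => ?_
  have := Real.sinh_pos_iff.2 ht
  positivity

/-- The kernel of the heat semigroup. -/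
def heatKernel (θ ξ μ : ℝ) (x : Plane) (t : ℝ) (y : Plane) : ℂ :=
  (phiIntegrand θ ξ μ (x - y) t : ℂ) * Complex.exp (Complex.I * (-(2 * ξ * thetaForm θ x y) : ℝ))

/-- The conjugate of the kernel of the heat semigroup, as a Schwartz function. -/
def heatSchwartz (hθ : 0 < θ) (hξ : 0 < ξ) (μ : ℝ) (x : Plane) {t : ℝ} (ht : 0 < t) :
    𝓢(Plane, ℂ) :=
  (heatAmp θ ξ μ t : ℂ) • magGauss θ ξ (heatWidth_pos hθ hξ ht) x

theorem conj_heatSchwartz (hθ : 0 < θ) (hξ : 0 < ξ) (μ : ℝ) (x : Plane) {t : ℝ} (ht : 0 < t)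
    (y : Plane) : starRingEnd ℂ (heatSchwartz hθ hξ μ x ht y) = heatKernel θ ξ μ x t y := by
  rw [heatSchwartz, smul_apply, magGauss_apply, heatKernel, phiIntegrand_eq,
    gaussExponent, smul_eq_mul, map_mul, Complex.conj_ofReal, ← Complex.exp_conj]
  rw [Complex.ofReal_mul (heatAmp _ _ _ _), Complex.ofReal_exp, mul_assoc ((heatAmp _ _ _ _ : ℝ) : ℂ),
    ← Complex.exp_add]
  congr 2
  push_cast
  simp only [map_sub, map_mul, map_pow, Complex.conj_ofReal, Complex.conj_I, Complex.conj_ofNat]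
  ring

theorem landau_heatSchwartz (hθ : 0 < θ) (hξ : 0 < ξ) (μ : ℝ) (x : Plane) {t : ℝ} (ht : 0 < t)
    (y : Plane) : (landauSchwartz θ ξ (heatSchwartz hθ hξ μ x ht) +
      (μ : ℂ) ^ 2 • heatSchwartz hθ hξ μ x ht) y =
      (heatSymbol θ ξ μ t ‖x - y‖ : ℂ) * heatSchwartz hθ hξ μ x ht y := by
  rw [heatSchwartz, map_smul, add_apply, smul_apply,
    landauSchwartz_magGauss hθ.ne', smul_apply, smul_apply, heatSymbol]
  simp only [smul_eq_mul]
  push_cast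
  ring

theorem norm_heatKernel (θ ξ μ : ℝ) (x : Plane) {t : ℝ} (ht : 0 ≤ t) (y : Plane) :
    ‖heatKernel θ ξ μ x t y‖ = phiIntegrand θ ξ μ (x - y) t := by
  rw [heatKernel, norm_mul, norm_cexp_I_mul, mul_one, Complex.norm_real,
    Real.norm_of_nonneg (phiIntegrand_nonneg θ ξ μ _ ht)]

theorem integral_heatKernel_mul (hθ : 0 < θ) (hξ : 0 < ξ) (μ : ℝ) (x : Plane) {t : ℝ} (ht : 0 < t)
    (h : L2Plane) : ∫ y, heatKernel θ ξ μ x t y * h y =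
      inner ℂ (toL2 (heatSchwartz hθ hξ μ x ht)) h := by
  rw [inner_toL2_left]
  simp only [conj_heatSchwartz]

theorem integrable_schwartz_mul (f : 𝓢(Plane, ℂ)) (h : L2Plane) : Integrable fun y => f y * h y :=
  (f.memLp 2 volume).integrable_mul (Lp.memLp h)

/-- A dominating function for differentiation under the integral, uniform for `t` near `t₀`. As the
width is at least `ξ/θ`, half of the Gaussian absorbs the quadratic symbol and the other half
remains. -/
theorem phiIntegrand_deriv_bound (hθ : 0 < θ) (hξ : 0 < ξ) (μ : ℝ) {t₀ : ℝ} (ht₀ : 0 < t₀) :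
    ∃ K : ℝ, ∀ t ∈ Icc (t₀ / 2) (2 * t₀), ∀ v : Plane,
      |θ / (4 * ξ) * heatSymbol θ ξ μ t ‖v‖ * phiIntegrand θ ξ μ v t| ≤
        K * Real.exp (-(ξ / (2 * θ) * ‖v‖ ^ 2)) := by
  have hsub : Icc (t₀ / 2) (2 * t₀) ⊆ Ioi 0 := fun t ht => lt_of_lt_of_le (by positivity) ht.1
  obtain ⟨A, hA⟩ := isCompact_Icc.exists_bound_of_continuousOn
    ((continuousOn_heatAmp θ ξ μ).mono hsub)
  obtain ⟨W, hW⟩ := isCompact_Icc.exists_bound_of_continuousOn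
    ((continuousOn_heatWidth θ ξ).mono hsub)
  have hc : 0 < ξ / (2 * θ) := by positivity
  set G := (Nat.factorial 2) * Real.exp (1 + 1 / (4 * (ξ / (2 * θ)))) with hG
  set P := 4 * W + 4 * ((ξ / θ) ^ 2 + W ^ 2) + μ ^ 2 with hP
  refine ⟨θ / (4 * ξ) * P * A * G, fun t ht v => ?_⟩
  have ht0 : 0 < t := hsub ht
  have h1 : heatAmp θ ξ μ t ≤ A := (le_abs_self _).trans (hA t ht)
  have h2 : heatWidth θ ξ t ≤ W := (le_abs_self _).trans (hW t ht)
  have hw0 := heatWidth_pos hθ hξ ht0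
  have ha0 := heatAmp_pos θ ξ μ ht0
  set r := ‖v‖
  have hr : 0 ≤ r := norm_nonneg v
  have hW0 : 0 ≤ W := hw0.le.trans h2
  have hsymb : |heatSymbol θ ξ μ t r| ≤ P * (1 + r) ^ 2 := by
    have hw2 : heatWidth θ ξ t ^ 2 ≤ W ^ 2 := by gcongr
    have hr1 : 1 ≤ (1 + r) ^ 2 := by nlinarith
    have hr2 : r ^ 2 ≤ (1 + r) ^ 2 := by nlinarith
    have hd : |(ξ / θ) ^ 2 - heatWidth θ ξ t ^ 2| ≤ (ξ / θ) ^ 2 + W ^ 2 := by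
      rw [abs_le]
      constructor <;> nlinarith [sq_nonneg (ξ / θ), sq_nonneg (heatWidth θ ξ t)]
    calc |heatSymbol θ ξ μ t r| ≤ |4 * heatWidth θ ξ t| +
          |4 * ((ξ / θ) ^ 2 - heatWidth θ ξ t ^ 2) * r ^ 2| + |μ ^ 2| :=
          abs_add_three _ _ _
      _ = 4 * heatWidth θ ξ t + 4 * |(ξ / θ) ^ 2 - heatWidth θ ξ t ^ 2| * r ^ 2 + μ ^ 2 := by
          rw [abs_mul, abs_mul, abs_mul, abs_of_pos hw0, abs_of_nonneg (sq_nonneg r),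
            abs_of_nonneg (sq_nonneg μ), abs_of_pos (by norm_num : (0 : ℝ) < 4)]
      _ ≤ 4 * W * (1 + r) ^ 2 + 4 * ((ξ / θ) ^ 2 + W ^ 2) * (1 + r) ^ 2 + μ ^ 2 * (1 + r) ^ 2 := by
          gcongr ?_ + ?_ + ?_
          · exact (by gcongr : 4 * heatWidth θ ξ t ≤ 4 * W).trans
              (le_mul_of_one_le_right (by positivity) hr1)
          · gcongr
          · exact le_mul_of_one_le_right (by positivity) hr1
      _ = _ := by rw [hP]; ring
  have hexp : Real.exp (-(heatWidth θ ξ t * r ^ 2)) ≤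
      Real.exp (-(ξ / (2 * θ) * r ^ 2)) * Real.exp (-(ξ / (2 * θ) * r ^ 2)) := by
    rw [← Real.exp_add]
    refine Real.exp_le_exp.2 ?_
    have e : ξ / θ * r ^ 2 = ξ / (2 * θ) * r ^ 2 + ξ / (2 * θ) * r ^ 2 := by field_simp; ring
    have := mul_le_mul_of_nonneg_right (le_heatWidth hθ hξ ht0) (sq_nonneg r)
    linarith
  have hA0 : 0 ≤ A := ha0.le.trans h1
  have hP0 : 0 ≤ P := by positivity
  rw [phiIntegrand_eq, abs_mul, abs_mul, abs_of_pos (by positivity : 0 < θ / (4 * ξ)),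
    abs_of_pos (by positivity : 0 < heatAmp θ ξ μ t * Real.exp (-(heatWidth θ ξ t * r ^ 2)))]
  calc _ ≤ θ / (4 * ξ) * (P * (1 + r) ^ 2) * (A * (Real.exp (-(ξ / (2 * θ) * r ^ 2)) *
        Real.exp (-(ξ / (2 * θ) * r ^ 2)))) := by gcongr
    _ = θ / (4 * ξ) * P * A * ((1 + r) ^ 2 * Real.exp (-(ξ / (2 * θ) * r ^ 2))) *
        Real.exp (-(ξ / (2 * θ) * r ^ 2)) := by ring
    _ ≤ _ := by
        gcongr
        exact one_add_pow_mul_exp_neg_le 2 hc hr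

/-- The heat equation in weak form: the Landau operator acts on the Schwartz kernel, so `h` need
only be square integrable. -/
theorem hasDerivAt_integral_heatKernel (hθ : 0 < θ) (hξ : 0 < ξ) (μ : ℝ) (x : Plane) {t : ℝ}
    (ht : 0 < t) (h : L2Plane) :
    HasDerivAt (fun t => ∫ y, heatKernel θ ξ μ x t y * h y)
      (-(θ / (4 * ξ) : ℝ) * inner ℂ (toL2 (landauSchwartz θ ξ (heatSchwartz hθ hξ μ x ht) +
        (μ : ℂ) ^ 2 • heatSchwartz hθ hξ μ x ht)) h) t := by
  obtain ⟨K, hK⟩ := phiIntegrand_deriv_bound hθ hξ μ ht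
  set F' : ℝ → Plane → ℂ := fun t y =>
    ((-(θ / (4 * ξ)) * heatSymbol θ ξ μ t ‖x - y‖ : ℝ) : ℂ) * heatKernel θ ξ μ x t y * h y with hF'
  have hint : ∀ s, (hs : 0 < s) → Integrable fun y => heatKernel θ ξ μ x s y * h y := fun s hs => by
    have h1 := ((SchwartzMap.memLp (heatSchwartz hθ hξ μ x hs) 2 volume).star).integrable_mul
      (Lp.memLp h)
    refine h1.congr (ae_of_all _ fun y => ?_)
    simp only [← conj_heatSchwartz hθ hξ μ x hs]
    rfl
  have hcb : 0 < ξ / (2 * θ) := by positivity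
  have hbound : Integrable fun y => K * (‖magGauss θ ξ hcb x y * h y‖) :=
    (integrable_schwartz_mul _ h).norm.const_mul _
  have hF'int : ∫ y, F' t y = -(θ / (4 * ξ) : ℝ) *
      inner ℂ (toL2 (landauSchwartz θ ξ (heatSchwartz hθ hξ μ x ht) +
        (μ : ℂ) ^ 2 • heatSchwartz hθ hξ μ x ht)) h := by
    rw [inner_toL2_left, ← integral_const_mul]
    refine integral_congr_ae (ae_of_all _ fun y => ?_)
    simp only [landau_heatSchwartz, map_mul, Complex.conj_ofReal, conj_heatSchwartz, hF']
    push_cast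
    ring
  rw [← hF'int]
  refine (hasDerivAt_integral_of_dominated_loc_of_deriv_le (F' := F')
    (s := Icc (t / 2) (2 * t)) (Icc_mem_nhds (by linarith) (by linarith))
    ?_ (hint t ht) ?_ ?_ hbound ?_).2
  · filter_upwards [lt_mem_nhds ht] with s hs
    exact (hint s hs).aestronglyMeasurable
  · have hc : Continuous fun y : Plane => ((-(θ / (4 * ξ)) * heatSymbol θ ξ μ t ‖x - y‖ : ℝ) : ℂ) := by
      unfold heatSymbol
      fun_prop
    simp only [hF', mul_assoc]
    exact hc.aestronglyMeasurable.mul (hint t ht).aestronglyMeasurable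
  · filter_upwards with y s hs
    have hs0 : 0 < s := lt_of_lt_of_le (by positivity) hs.1
    have h1 := hK s hs (x - y)
    rw [hF', norm_mul, norm_mul, norm_heatKernel θ ξ μ x hs0.le, Complex.norm_real,
      norm_mul (magGauss _ _ _ _ _), magGauss_apply, norm_cexp_gaussExponent, ← mul_assoc]
    refine mul_le_mul_of_nonneg_right (le_trans (le_of_eq ?_) h1) (norm_nonneg _)
    rw [abs_mul, abs_of_nonneg (phiIntegrand_nonneg θ ξ μ (x - y) hs0.le), neg_mul, norm_neg,
      Real.norm_eq_abs]
  · filter_upwards with y s hs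
    have hs0 : 0 < s := lt_of_lt_of_le (by positivity) hs.1
    have h1 := (((hasDerivAt_phiIntegrand hθ hξ μ (x - y) hs0).ofReal_comp).mul_const
      (Complex.exp (Complex.I * (-(2 * ξ * thetaForm θ x y) : ℝ)))).mul_const (h y)
    refine h1.congr_deriv ?_
    simp only [hF', heatKernel]
    push_cast
    ring

/-- The width never falls below `ξ/θ`, so a single Gaussian dominates at all times and only the
amplitude depends on `t`. -/
theorem norm_integral_heatKernel_le (hθ : 0 < θ) (hξ : 0 < ξ) (μ : ℝ) (x : Plane)
    (h : L2Plane) : ∃ K : ℝ, ∀ t > 0, ‖∫ y, heatKernel θ ξ μ x t y * h y‖ ≤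
      heatAmp θ ξ μ t * K := by
  have hc : 0 < ξ / θ := by positivity
  refine ⟨∫ y, ‖magGauss θ ξ hc x y * h y‖, fun t ht => ?_⟩
  rw [← integral_const_mul]
  refine norm_integral_le_of_norm_le ((integrable_schwartz_mul _ h).norm.const_mul _)
    (ae_of_all _ fun y => ?_)
  rw [norm_mul, norm_mul, norm_heatKernel θ ξ μ x ht.le, magGauss_apply, norm_cexp_gaussExponent,
    phiIntegrand_eq, ← mul_assoc]
  have := (heatAmp_pos θ ξ μ ht).le
  gcongr
  exact le_heatWidth hθ hξ ht

theorem tendsto_heatAmp_atTop (hθ : 0 < θ) (hξ : 0 < ξ) (μ : ℝ) :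
    Tendsto (heatAmp θ ξ μ) atTop (𝓝 0) := by
  have h1 : Tendsto (fun t => 1 / (4 * Real.pi * t)) atTop (𝓝 0) := by
    refine tendsto_const_nhds.div_atTop (tendsto_id.const_mul_atTop (by positivity))
  refine tendsto_of_tendsto_of_tendsto_of_le_of_le' tendsto_const_nhds h1 ?_ ?_
  · filter_upwards [eventually_gt_atTop 0] with t ht using (heatAmp_pos θ ξ μ ht).le
  · filter_upwards [eventually_gt_atTop 0] with t ht
    rw [heatAmp]
    have h2 : t ≤ Real.sinh t := Real.self_le_sinh_iff.2 ht.le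
    have h3 : Real.exp (-(t * (θ * μ ^ 2 / (4 * ξ)))) ≤ 1 :=
      Real.exp_le_one_iff.2 (by have : 0 ≤ t * (θ * μ ^ 2 / (4 * ξ)) := by positivity
                                linarith)
    gcongr

theorem tendsto_integral_heatKernel_atTop (hθ : 0 < θ) (hξ : 0 < ξ) (μ : ℝ) (x : Plane)
    (h : L2Plane) :
    Tendsto (fun t => ∫ y, heatKernel θ ξ μ x t y * h y) atTop (𝓝 0) := by
  obtain ⟨K, hK⟩ := norm_integral_heatKernel_le hθ hξ μ x h
  have h1 := (tendsto_heatAmp_atTop hθ hξ μ).mul_const K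
  rw [zero_mul] at h1
  refine squeeze_zero_norm' ?_ h1
  filter_upwards [eventually_gt_atTop 0] with t ht using hK t ht

theorem tendsto_heatWidth_zero (hθ : 0 < θ) (hξ : 0 < ξ) :
    Tendsto (heatWidth θ ξ) (𝓝[>] 0) atTop := by
  have h1 : Tendsto Real.sinh (𝓝[>] 0) (𝓝[>] 0) := by
    refine tendsto_nhdsWithin_iff.2 ⟨?_, ?_⟩
    · have := Real.continuous_sinh.tendsto 0
      rw [Real.sinh_zero] at this
      exact this.mono_left nhdsWithin_le_nhds
    · filter_upwards [self_mem_nhdsWithin] with t ht using Real.sinh_pos_iff.2 ht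
  have h2 : Tendsto Real.cosh (𝓝[>] 0) (𝓝 1) := by
    have := Real.continuous_cosh.tendsto 0
    rw [Real.cosh_zero] at this
    exact this.mono_left nhdsWithin_le_nhds
  have h3 := (h2.pos_mul_atTop one_pos (tendsto_inv_nhdsGT_zero.comp h1)).const_mul_atTop
    (by positivity : 0 < ξ / θ)
  exact h3

/-- The heat kernel is an approximate identity: its width tends to infinity, its mass `θ
exp(-tθμ²/(4ξ)) / (4ξ cosh t)` tends to `θ/(4ξ)`, and the phase is `1` at `y = x`. -/
theorem tendsto_integral_heatKernel_zero (hθ : 0 < θ) (hξ : 0 < ξ) (μ : ℝ) (x : Plane)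
    (f : 𝓢(Plane, ℂ)) :
    Tendsto (fun t => ∫ y, heatKernel θ ξ μ x t y * f y) (𝓝[>] 0)
      (𝓝 ((θ / (4 * ξ) : ℝ) * f x)) := by
  set g : Plane → ℂ := fun y =>
    Complex.exp (Complex.I * (-(2 * ξ * thetaForm θ x y) : ℝ)) * f y with hg
  have hphase : Continuous fun y : Plane =>
      Complex.exp (Complex.I * (-(2 * ξ * thetaForm θ x y) : ℝ)) := by
    simp only [← thetaCLM_apply]
    fun_prop
  have hgc : Continuous g := hphase.mul f.continuous
  have hgi : Integrable g := f.integrable.bdd_mul hphase.aestronglyMeasurable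
    (ae_of_all _ fun y => (norm_cexp_I_mul _).le)
  have h1 := Real.tendsto_integral_gaussian_smul' hgi (hgc.continuousAt (x := x))
  -- The normalised Gaussian of `h1` has exponent `-π² c |x - y|²`, so `c` must be the width divided
  -- by `π²`.
  have h2 : Tendsto (fun t => heatWidth θ ξ t / Real.pi ^ 2) (𝓝[>] 0) atTop :=
    (tendsto_heatWidth_zero hθ hξ).atTop_div_const (by positivity)
  have h3 : Tendsto (fun t => heatAmp θ ξ μ t * (Real.pi / heatWidth θ ξ t)) (𝓝[>] 0)
      (𝓝 (θ / (4 * ξ))) := by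
    have h4 : Tendsto (fun t => Real.exp (-(t * (θ * μ ^ 2 / (4 * ξ)))) * (θ / (4 * ξ)) /
        Real.cosh t) (𝓝[>] 0) (𝓝 (θ / (4 * ξ))) := by
      have : Continuous fun t => Real.exp (-(t * (θ * μ ^ 2 / (4 * ξ)))) * (θ / (4 * ξ)) /
        Real.cosh t := by
        refine Continuous.div (by fun_prop) Real.continuous_cosh fun t => (Real.cosh_pos t).ne'
      have h5 := this.tendsto 0
      simp only [zero_mul, neg_zero, Real.exp_zero, one_mul, Real.cosh_zero, div_one] at h5
      exact h5.mono_left nhdsWithin_le_nhds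
    refine h4.congr' ?_
    filter_upwards [self_mem_nhdsWithin] with t ht
    have := Real.sinh_pos_iff.2 ht
    have := Real.cosh_pos t
    rw [heatAmp, heatWidth]
    field_simp
  have h6 := (Complex.continuous_ofReal.tendsto _ |>.comp h3).mul (h1.comp h2)
  have hgx : g x = f x := by simp [hg, thetaForm_self]
  rw [hgx] at h6
  refine h6.congr' ?_
  filter_upwards [self_mem_nhdsWithin] with t ht
  have hw := heatWidth_pos hθ hξ ht
  simp only [Function.comp_apply]
  rw [← integral_const_mul]
  refine integral_congr_ae (ae_of_all _ fun y => ?_)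
  simp only [hg, heatKernel, phiIntegrand_eq, finrank_euclideanSpace, Fintype.card_fin, smul_eq_mul]
  have e1 : ((2 : ℕ) : ℂ) / 2 = 1 := by norm_num
  rw [e1, Complex.cpow_one]
  have hp : (Real.pi : ℂ) ≠ 0 := by exact_mod_cast Real.pi_ne_zero
  have hw' : (heatWidth θ ξ t : ℂ) ≠ 0 := by exact_mod_cast hw.ne'
  have e2 : -(Real.pi : ℂ) ^ 2 * ((heatWidth θ ξ t / Real.pi ^ 2 : ℝ) : ℂ) * (‖x - y‖ : ℂ) ^ 2 =
      ((-(heatWidth θ ξ t * ‖x - y‖ ^ 2) : ℝ) : ℂ) := by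
    push_cast
    field_simp
  rw [e2]
  push_cast
  field_simp

end HeatFlow

/-! ### The resolvent of the Landau Hamiltonian -/

section Resolvent

open Filter Topology

variable {θ ξ : ℝ}

/-- The kernel of the resolvent of the Landau Hamiltonian. -/
def resKernel (θ ξ μ : ℝ) (x y : Plane) : ℂ :=
  (Phi θ ξ μ (x - y) : ℂ) * Complex.exp (Complex.I * (-(2 * ξ * thetaForm θ x y) : ℝ))

theorem Phi_neg (θ ξ μ : ℝ) (v : Plane) : Phi θ ξ μ (-v) = Phi θ ξ μ v := by
  simp only [Phi, phiIntegrand, norm_neg]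

theorem isSchurKernel_resKernel (hθ : 0 < θ) (hξ : 0 < ξ) (μ : ℝ) :
    IsSchurKernel volume (resKernel θ ξ μ) (∫⁻ v, ‖(Phi θ ξ μ v : ℂ)‖ₑ).toNNReal := by
  refine isSchurKernel_conv (k := fun v => (Phi θ ξ μ v : ℂ))
    (Complex.measurable_ofReal.comp (measurable_Phi θ ξ μ))
    (integrable_Phi hθ hξ μ).ofReal.2 ?_
  exact ((measurable_thetaForm θ).const_mul (2 * ξ)).neg

/-- The resolvent of the Landau Hamiltonian. -/
def resolvent (hθ : 0 < θ) (hξ : 0 < ξ) (μ : ℝ) : L2Plane →L[ℂ] L2Plane :=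
  (isSchurKernel_resKernel hθ hξ μ).op

theorem conj_resKernel (θ ξ μ : ℝ) (x y : Plane) :
    resKernel θ ξ μ x y = starRingEnd ℂ (resKernel θ ξ μ y x) := by
  rw [resKernel, resKernel, map_mul, Complex.conj_ofReal, ← Complex.exp_conj, map_mul,
    Complex.conj_I, Complex.conj_ofReal, thetaForm_swap θ x y, ← neg_sub x y, Phi_neg]
  push_cast
  ring_nf

theorem inner_resolvent (hθ : 0 < θ) (hξ : 0 < ξ) (μ : ℝ) (φ ψ : L2Plane) :
    inner ℂ (resolvent hθ hξ μ φ) ψ = inner ℂ φ (resolvent hθ hξ μ ψ) :=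
  (isSchurKernel_resKernel hθ hξ μ).inner_op_left (conj_resKernel θ ξ μ) φ ψ

theorem Phi_nonneg (θ ξ μ : ℝ) (v : Plane) : 0 ≤ Phi θ ξ μ v :=
  setIntegral_nonneg measurableSet_Ioi fun _ ht => phiIntegrand_nonneg θ ξ μ v (le_of_lt ht)

theorem measurable_heatKernel (θ ξ μ : ℝ) (x : Plane) :
    Measurable fun p : Plane × ℝ => heatKernel θ ξ μ x p.2 p.1 := by
  have h1 : Measurable fun p : Plane × ℝ => phiIntegrand θ ξ μ (x - p.1) p.2 :=
    (measurable_phiIntegrand θ ξ μ).comp (by fun_prop : Measurable fun p : Plane × ℝ =>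
      (x - p.1, p.2))
  have h2 : Measurable fun p : Plane × ℝ => thetaForm θ x p.1 :=
    (measurable_thetaForm θ).comp (by fun_prop : Measurable fun p : Plane × ℝ => (x, p.1))
  exact (Complex.measurable_ofReal.comp h1).mul
    ((Complex.measurable_ofReal.comp (h2.const_mul (2 * ξ)).neg).const_mul Complex.I).cexp

/-- Integrating the norm over `t` gives `Φ(x - y) |h y|`, which is the norm of the resolvent kernel
times `h`. The point `y = x`, where the `t` integral may diverge, is null. -/
theorem integrable_heatKernel_mul (hθ : 0 < θ) (hξ : 0 < ξ) (μ : ℝ) (x : Plane) {h : Plane → ℂ}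
    (hm : AEStronglyMeasurable h volume) (hi : Integrable fun y => resKernel θ ξ μ x y * h y) :
    Integrable (fun p : Plane × ℝ => heatKernel θ ξ μ x p.2 p.1 * h p.1)
      (volume.prod (volume.restrict (Ioi 0))) := by
  have hmeas : AEStronglyMeasurable (fun p : Plane × ℝ => heatKernel θ ξ μ x p.2 p.1 * h p.1)
      (volume.prod (volume.restrict (Ioi 0))) :=
    (measurable_heatKernel θ ξ μ x).aestronglyMeasurable.mul hm.comp_fst
  have hn : ∀ y, ∀ t ∈ Ioi (0 : ℝ), ‖heatKernel θ ξ μ x t y * h y‖ =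
      phiIntegrand θ ξ μ (x - y) t * ‖h y‖ := fun y t ht => by
    rw [norm_mul, norm_heatKernel θ ξ μ x (le_of_lt ht)]
  refine (integrable_prod_iff hmeas).2 ⟨?_, ?_⟩
  · filter_upwards [compl_mem_ae_iff.2 (measure_singleton x)] with y hy
    have hv : x - y ≠ 0 := sub_ne_zero.2 fun h => hy h.symm
    have h1 := (phiIntegrand_integrableOn hθ hξ μ hv).mul_const ‖h y‖
    refine h1.mono' ?_ ?_
    · exact ((measurable_heatKernel θ ξ μ x).comp measurable_prodMk_left).aestronglyMeasurable.mul
        aestronglyMeasurable_const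
    · filter_upwards [ae_restrict_mem measurableSet_Ioi] with t ht using (hn y t ht).le
  · refine hi.norm.congr (ae_of_all _ fun y => ?_)
    simp only
    rw [setIntegral_congr_fun measurableSet_Ioi (hn y), integral_mul_const, norm_mul, resKernel,
      norm_mul, norm_cexp_I_mul, mul_one, Complex.norm_real, Real.norm_of_nonneg (Phi_nonneg _ _ _ _)]
    rfl

theorem integral_resKernel_mul (hθ : 0 < θ) (hξ : 0 < ξ) (μ : ℝ) (x : Plane) {h : Plane → ℂ}
    (hm : AEStronglyMeasurable h volume) (hi : Integrable fun y => resKernel θ ξ μ x y * h y) :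
    IntegrableOn (fun t => ∫ y, heatKernel θ ξ μ x t y * h y) (Ioi 0) ∧
    ∫ y, resKernel θ ξ μ x y * h y = ∫ t in Ioi 0, ∫ y, heatKernel θ ξ μ x t y * h y := by
  have hint := integrable_heatKernel_mul hθ hξ μ x hm hi
  refine ⟨hint.integral_prod_right, ?_⟩
  rw [← integral_integral_swap hint]
  refine integral_congr_ae (ae_of_all _ fun y => ?_)
  simp only [heatKernel]
  rw [integral_mul_const, integral_mul_const, integral_complex_ofReal]
  rfl

/-- With `u(t)` the heat flow of `f` at `x`, symmetry gives `u' = -(θ/(4ξ))` times the heat flow of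
`(H_L + μ²) f`. Since `u` runs from `(θ/(4ξ)) f x` to `0`, integrating over `t` leaves `f x`. -/
theorem resolvent_landauSchwartz (hθ : 0 < θ) (hξ : 0 < ξ) (μ : ℝ) (f : 𝓢(Plane, ℂ)) :
    resolvent hθ hξ μ (toL2 (landauSchwartz θ ξ f + (μ : ℂ) ^ 2 • f)) = toL2 f := by
  set k := landauSchwartz θ ξ f + (μ : ℂ) ^ 2 • f with hk
  have hS := isSchurKernel_resKernel hθ hξ μ
  refine Lp.ext ?_
  filter_upwards [hS.op_apply_ae (toL2 k), hS.ae_integrable (toL2 k),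
    f.coeFn_toLp 2 volume] with x h1 h2 h3
  have h3' : (toL2 f : Plane → ℂ) x = f x := h3
  obtain ⟨h4, h5⟩ := integral_resKernel_mul hθ hξ μ x (Lp.aestronglyMeasurable (toL2 k)) h2
  rw [h3', resolvent, h1, h5]
  set u : ℝ → ℂ := fun t => ∫ y, heatKernel θ ξ μ x t y * toL2 f y with hu
  have hB : (θ / (4 * ξ) : ℝ) ≠ 0 := by positivity
  have hu' : ∀ t ∈ Ioi (0 : ℝ), HasDerivAt u (-(θ / (4 * ξ) : ℝ) *
      ∫ y, heatKernel θ ξ μ x t y * toL2 k y) t := fun t ht => by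
    have ht' : 0 < t := ht
    refine (hasDerivAt_integral_heatKernel hθ hξ μ x ht' (toL2 f)).congr_deriv ?_
    rw [integral_heatKernel_mul hθ hξ μ x ht', hk]
    congr 1
    simp only [map_add, map_smul, inner_add_left, inner_add_right, inner_smul_left,
      inner_smul_right, inner_toL2_landauSchwartz, map_pow, Complex.conj_ofReal]
  have hu0 : Tendsto u (𝓝[>] 0) (𝓝 ((θ / (4 * ξ) : ℝ) * f x)) := by
    refine (tendsto_integral_heatKernel_zero hθ hξ μ x f).congr fun t => ?_
    refine integral_congr_ae ?_
    filter_upwards [f.coeFn_toLp 2 volume] with y hy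
    have hy' : (toL2 f : Plane → ℂ) y = f y := hy
    rw [hy']
  have hut : Tendsto u atTop (𝓝 0) := tendsto_integral_heatKernel_atTop hθ hξ μ x (toL2 f)
  -- At `t = 0` division by `sinh 0` makes `u` take the default value `0`; it is replaced by the
  -- limit to obtain continuity from the right.
  have hfin := integral_Ioi_of_hasDerivAt_of_tendsto (a := 0)
    (f := Function.update u 0 ((θ / (4 * ξ) : ℝ) * f x)) (m := 0)
    (f' := fun t => -(θ / (4 * ξ) : ℝ) * ∫ y, heatKernel θ ξ μ x t y * toL2 k y) ?_ ?_ ?_ ?_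
  · rw [integral_const_mul, Function.update_self, zero_sub, neg_mul, neg_inj] at hfin
    exact mul_left_cancel₀ (by exact_mod_cast hB) hfin
  · rw [continuousWithinAt_update_same]
    simpa using hu0
  · intro t ht
    refine (hu' t ht).congr_of_eventuallyEq ?_
    filter_upwards [lt_mem_nhds (show (0 : ℝ) < t from ht)] with s hs
    exact Function.update_of_ne hs.ne' _ _
  · exact h4.const_mul _
  · refine hut.congr' ?_
    filter_upwards [eventually_gt_atTop 0] with s hs
    exact (Function.update_of_ne hs.ne' _ _).symm

/-- Every Schwartz `f` is `R k` for some `k`, so `⟨h, f⟩ = ⟨R h, k⟩ = 0` by symmetry, and Schwartz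
functions are dense. -/
theorem eq_zero_of_resolvent_eq_zero (hθ : 0 < θ) (hξ : 0 < ξ) (μ : ℝ) {h : L2Plane}
    (hh : resolvent hθ hξ μ h = 0) : h = 0 := by
  have hd : DenseRange toL2 :=
    SchwartzMap.denseRange_toLpCLM (E := Plane) (F := ℂ) (p := 2) (by simp)
  refine hd.eq_zero_of_inner_left ℂ fun f => ?_
  rw [← resolvent_landauSchwartz hθ hξ μ f, ← inner_resolvent, hh, inner_zero_left]

/-- The range of `H_L + μ²` on Schwartz functions has trivial orthogonal complement. -/
theorem eq_zero_of_inner_landauSchwartz (hθ : 0 < θ) (hξ : 0 < ξ) (μ : ℝ) {h : L2Plane}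
    (hh : ∀ g : 𝓢(Plane, ℂ), inner ℂ (toL2 (landauSchwartz θ ξ g + (μ : ℂ) ^ 2 • g)) h = 0) :
    h = 0 := by
  refine eq_zero_of_resolvent_eq_zero hθ hξ μ ?_
  have hS := isSchurKernel_resKernel hθ hξ μ
  refine Lp.ext ?_
  filter_upwards [hS.op_apply_ae h, hS.ae_integrable h, Lp.coeFn_zero ℂ 2 volume] with x h1 h2 h3
  obtain ⟨-, h5⟩ := integral_resKernel_mul hθ hξ μ x (Lp.aestronglyMeasurable h) h2
  rw [h3, resolvent, h1, h5]
  refine setIntegral_eq_zero_of_forall_eq_zero fun t ht => ?_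
  -- Orthogonality kills the time derivative, so the heat flow of `h` is constant; as it tends to
  -- `0` at infinity, it vanishes.
  have hderiv : ∀ s ∈ Ioi (0 : ℝ), HasDerivAt (fun t => ∫ y, heatKernel θ ξ μ x t y * h y) 0 s :=
    fun s hs => (hasDerivAt_integral_heatKernel hθ hξ μ x hs h).congr_deriv (by rw [hh, mul_zero])
  have hconst : ∀ s ∈ Ioi (0 : ℝ), ∫ y, heatKernel θ ξ μ x s y * h y =
      ∫ y, heatKernel θ ξ μ x t y * h y := fun s hs =>
    isOpen_Ioi.is_const_of_deriv_eq_zero (𝕜 := ℝ) isPreconnected_Ioi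
      (fun r hr => (hderiv r hr).differentiableAt.differentiableWithinAt)
      (fun r hr => (hderiv r hr).deriv) hs ht
  refine tendsto_nhds_unique (tendsto_const_nhds.congr' ?_)
    (tendsto_integral_heatKernel_atTop hθ hξ μ x h)
  filter_upwards [eventually_gt_atTop 0] with s hs using (hconst s hs).symm

/-- The relation is closed in `(a, b)` because `R` is bounded, and it holds on the graph over
Schwartz functions. -/
theorem resolvent_of_mem_closure (hθ : 0 < θ) (hξ : 0 < ξ) (μ : ℝ) {a b : L2Plane}
    (hp : (a, b) ∈ (landauMin θ ξ).graph.topologicalClosure) :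
    resolvent hθ hξ μ (b + (μ : ℂ) ^ 2 • a) = a := by
  have hcl : IsClosed {p : L2Plane × L2Plane |
      resolvent hθ hξ μ (p.2 + (μ : ℂ) ^ 2 • p.1) = p.1} :=
    isClosed_eq (by fun_prop) (by fun_prop)
  suffices hsub : ((landauMin θ ξ).graph : Set (L2Plane × L2Plane)) ⊆ {p : L2Plane × L2Plane |
      resolvent hθ hξ μ (p.2 + (μ : ℂ) ^ 2 • p.1) = p.1} by
    have := closure_minimal hsub hcl hp
    rwa [mem_ofPred_eq] at this
  intro q hq
  obtain ⟨⟨y, f, rfl⟩, hy1, hy2⟩ := (LinearPMap.mem_graph_iff _).1 hq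
  have h1 := resolvent_landauSchwartz hθ hξ μ f
  have h2 := landauMin_apply θ ξ f ⟨f, rfl⟩
  simp only [mem_ofPred_eq]
  rw [← hy1, ← hy2]
  rw [map_add, map_smul] at h1
  exact (congrArg (fun z => resolvent hθ hξ μ (z + (μ : ℂ) ^ 2 • toL2 f)) h2).trans h1

/-- If `(0, b)` lies in the closure of the graph, then `R b = 0` and injectivity of `R` forces `b =
0`. -/
theorem landauMin_isClosable (hθ : 0 < θ) (hξ : 0 < ξ) : (landauMin θ ξ).IsClosable := by
  refine ⟨(landauMin θ ξ).graph.topologicalClosure.toLinearPMap, ?_⟩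
  rw [Submodule.toLinearPMap_graph_eq]
  rintro ⟨a, b⟩ hp hp1
  have h := resolvent_of_mem_closure hθ hξ 0 hp
  have ha : a = 0 := hp1
  rw [ha, smul_zero, add_zero] at h
  exact eq_zero_of_resolvent_eq_zero hθ hξ 0 h

theorem isBoundedInverse_resolvent (hθ : 0 < θ) (hξ : 0 < ξ) (μ : ℝ) :
    IsBoundedInverse (landauHamiltonian θ ξ) ((μ : ℂ) ^ 2) (resolvent hθ hξ μ) := by
  have hcl := (landauMin_isClosable hθ hξ).graph_closure_eq_closure_graph
  have hmem : ∀ g : 𝓢(Plane, ℂ), (toL2 g, toL2 (landauSchwartz θ ξ g)) ∈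
      (landauHamiltonian θ ξ).graph := fun g => by
    rw [landauHamiltonian, ← hcl]
    refine Submodule.le_topologicalClosure _ ?_
    rw [LinearPMap.mem_graph_iff]
    exact ⟨⟨toL2 g, g, rfl⟩, rfl, landauMin_apply θ ξ g ⟨g, rfl⟩⟩
  refine ⟨?_, ?_⟩
  · have hclosed : IsClosed {f : L2Plane | (resolvent hθ hξ μ f,
        f - (μ : ℂ) ^ 2 • resolvent hθ hξ μ f) ∈ (landauHamiltonian θ ξ).graph} := by
      have h1 : IsClosed ((landauHamiltonian θ ξ).graph : Set (L2Plane × L2Plane)) :=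
        (landauMin_isClosable hθ hξ).closure_isClosed
      exact h1.preimage (by fun_prop : Continuous fun f : L2Plane =>
        (resolvent hθ hξ μ f, f - (μ : ℂ) ^ 2 • resolvent hθ hξ μ f))
    let D : Submodule ℂ L2Plane := LinearMap.range
      ((toL2 ∘L (landauSchwartz θ ξ + (μ : ℂ) ^ 2 • ContinuousLinearMap.id ℂ _) :
        𝓢(Plane, ℂ) →L[ℂ] L2Plane) : 𝓢(Plane, ℂ) →ₗ[ℂ] L2Plane)
    -- The identity `R (H_L + μ²) g = g` puts the pair in the graph for every `f` in this range;
    -- density and `hclosed` extend this to all `f`.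
    have hD : Dense (D : Set L2Plane) := by
      rw [Submodule.dense_iff_topologicalClosure_eq_top,
        Submodule.topologicalClosure_eq_top_iff, Submodule.eq_bot_iff]
      intro h hh
      refine eq_zero_of_inner_landauSchwartz hθ hξ μ fun g => ?_
      exact (Submodule.mem_orthogonal _ _).1 hh _ ⟨g, rfl⟩
    have hall : ∀ f : L2Plane, (resolvent hθ hξ μ f,
        f - (μ : ℂ) ^ 2 • resolvent hθ hξ μ f) ∈ (landauHamiltonian θ ξ).graph := by
      intro f
      refine hclosed.closure_subset_iff.2 ?_ (hD f)
      rintro _ ⟨g, rfl⟩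
      have e := resolvent_landauSchwartz hθ hξ μ g
      have h2 := hmem g
      change (resolvent hθ hξ μ (toL2 (landauSchwartz θ ξ g + (μ : ℂ) ^ 2 • g)),
        toL2 (landauSchwartz θ ξ g + (μ : ℂ) ^ 2 • g) - (μ : ℂ) ^ 2 •
        resolvent hθ hξ μ (toL2 (landauSchwartz θ ξ g + (μ : ℂ) ^ 2 • g))) ∈
        (landauHamiltonian θ ξ).graph
      rw [e]
      simpa using h2
    intro f
    obtain ⟨y, hy1, hy2⟩ := (LinearPMap.mem_graph_iff _).1 (hall f)
    simp only at hy1 hy2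
    have hdom : resolvent hθ hξ μ f ∈ (landauHamiltonian θ ξ).domain := hy1 ▸ y.2
    refine ⟨hdom, ?_⟩
    have : y = ⟨resolvent hθ hξ μ f, hdom⟩ := Subtype.ext hy1
    rw [← this, hy2]
    simp
  · intro g
    have hg : ((g : L2Plane), landauHamiltonian θ ξ g) ∈
        (landauMin θ ξ).graph.topologicalClosure := by
      rw [hcl]
      exact LinearPMap.mem_graph _ g
    exact resolvent_of_mem_closure hθ hξ μ hg

end Resolvent

/-! ### Left Moyal multiplication as a twisted convolution -/

section Moyal

open FourierTransform

variable {θ : ℝ}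

/-- The rotation of the plane by a right angle. -/
def quarterTurn : Plane ≃ₗᵢ[ℝ] Plane :=
  LinearIsometry.toLinearIsometryEquiv
    { toFun := fun z => !₂[-z 1, z 0]
      map_add' := fun x y => by
        ext i
        fin_cases i <;> simp [add_comm]
      map_smul' := fun c x => by
        ext i
        fin_cases i <;> simp
      norm_map' := fun x => by
        rw [← sq_eq_sq₀ (norm_nonneg _) (norm_nonneg _), EuclideanSpace.real_norm_sq_eq,
          EuclideanSpace.real_norm_sq_eq]
        simp [Fin.sum_univ_two, add_comm] } rfl

theorem quarterTurn_apply (z : Plane) : quarterTurn z = !₂[-z 1, z 0] := rfl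

/-- Rotating and rescaling the frequency turns the character `exp(-2πi⟨u, ·⟩)` into `exp(-2i
uΘ⁻¹z)`, so ordinary Fourier theory applies to the symplectic transform. -/
theorem inner_quarterTurn (hθ : θ ≠ 0) (u z : Plane) :
    inner ℝ u ((Real.pi * θ)⁻¹ • quarterTurn z) = thetaForm θ u z / Real.pi := by
  rw [inner_smul_right, quarterTurn_apply, thetaForm, EuclideanSpace.inner_eq_star_dotProduct]
  simp [dotProduct, Fin.sum_univ_two]
  field_simp
  ring

theorem lintegral_comp_smul_quarterTurn {g : Plane → ℝ≥0∞} (hg : Measurable g) {r : ℝ} (hr : r ≠ 0)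
    (w : Plane) :
    ∫⁻ x, g (r • quarterTurn x + w) = ENNReal.ofReal ((r ^ 2)⁻¹) * ∫⁻ x, g x := by
  have h1 : ∫⁻ x, g (r • quarterTurn x + w) = ∫⁻ x, g (r • x + w) :=
    quarterTurn.measurePreserving.lintegral_comp (f := fun x => g (r • x + w)) (by fun_prop)
  have h2 : ∫⁻ x, g (r • x + w) = ∫⁻ x, g (x + w) ∂(Measure.map (r • ·) (volume : Measure Plane)) :=
    (lintegral_map (f := fun x => g (x + w)) (by fun_prop) (by fun_prop)).symm
  rw [h1, h2, Measure.map_addHaar_smul _ hr, lintegral_smul_measure,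
    lintegral_add_right_eq_self g w]
  simp [abs_of_nonneg, sq_nonneg]

/-- The symplectic Fourier transform of `a`, which is the convolution kernel of `L(a)`. -/
def moyalSymbol (θ : ℝ) (a : 𝓢(Plane, ℂ)) (z : Plane) : ℂ :=
  (1 / (Real.pi * θ) ^ 2 : ℝ) * 𝓕 (a : Plane → ℂ) ((Real.pi * θ)⁻¹ • quarterTurn z)

theorem fourier_smul_quarterTurn (hθ : θ ≠ 0) (g : Plane → ℂ) (z : Plane) :
    𝓕 g ((Real.pi * θ)⁻¹ • quarterTurn z) =
      ∫ u, Complex.exp (Complex.I * (-(2 * thetaForm θ u z) : ℝ)) * g u := by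
  rw [Real.fourier_eq']
  refine integral_congr_ae (ae_of_all _ fun u => ?_)
  simp only [inner_quarterTurn hθ, smul_eq_mul]
  congr 2
  have : (Real.pi : ℂ) ≠ 0 := by exact_mod_cast Real.pi_ne_zero
  push_cast
  field_simp

theorem moyalSymbol_eq (hθ : θ ≠ 0) (a : 𝓢(Plane, ℂ)) (z : Plane) :
    moyalSymbol θ a z = (1 / (Real.pi * θ) ^ 2 : ℝ) *
      ∫ u, Complex.exp (Complex.I * (-(2 * thetaForm θ u z) : ℝ)) * a u := by
  rw [moyalSymbol, fourier_smul_quarterTurn hθ]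

theorem continuous_moyalSymbol (θ : ℝ) (a : 𝓢(Plane, ℂ)) : Continuous (moyalSymbol θ a) := by
  have h : Continuous (𝓕 (a : Plane → ℂ)) := by
    rw [← SchwartzMap.fourier_coe]
    exact (𝓕 a).continuous
  unfold moyalSymbol
  fun_prop

theorem norm_moyalSymbol_le (θ : ℝ) (a : 𝓢(Plane, ℂ)) :
    ∃ C, ∀ z, ‖moyalSymbol θ a z‖ ≤ C := by
  refine ⟨‖((1 / (Real.pi * θ) ^ 2 : ℝ) : ℂ)‖ * SchwartzMap.seminorm ℝ 0 0 (𝓕 a), fun z => ?_⟩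
  rw [moyalSymbol, norm_mul, ← SchwartzMap.fourier_coe]
  gcongr
  exact SchwartzMap.norm_le_seminorm ℝ (𝓕 a) _

theorem lintegral_moyalSymbol_lt_top (hθ : θ ≠ 0) (a : 𝓢(Plane, ℂ)) :
    ∫⁻ z, ‖moyalSymbol θ a z‖ₑ < ∞ := by
  have hm : Measurable fun w => ‖𝓕 (a : Plane → ℂ) w‖ₑ := by
    rw [← SchwartzMap.fourier_coe]
    exact (𝓕 a).continuous.measurable.enorm
  have h := lintegral_comp_smul_quarterTurn hm
    (inv_ne_zero (mul_ne_zero Real.pi_ne_zero hθ)) 0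
  simp only [add_zero] at h
  simp only [moyalSymbol, enorm_mul]
  rw [lintegral_const_mul' _ _ (by simp), h]
  refine ENNReal.mul_lt_top (by simp) (ENNReal.mul_lt_top (by simp) ?_)
  rw [← SchwartzMap.fourier_coe]
  exact (𝓕 a).integrable.2

/-- The squared prefactor is `(πθ)⁻⁴`, and the change of variables in dimension two returns `(πθ)²`.
-/
theorem lintegral_moyalSymbol_sq_le (hθ : 0 < θ) (a : 𝓢(Plane, ℂ)) :
    ∫⁻ z, ‖moyalSymbol θ a z‖ₑ ^ 2 ≤
      ENNReal.ofReal (1 / (Real.pi * θ) ^ 2) * ∫⁻ u, ‖a u‖ₑ ^ 2 := by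
  have hm : Measurable fun w => ‖𝓕 (a : Plane → ℂ) w‖ₑ ^ 2 := by
    rw [← SchwartzMap.fourier_coe]
    exact (𝓕 a).continuous.measurable.enorm.pow_const 2
  have hp : 0 < Real.pi * θ := by positivity
  have h := lintegral_comp_smul_quarterTurn hm (inv_ne_zero hp.ne') 0
  simp only [add_zero] at h
  simp only [moyalSymbol, enorm_mul, mul_pow]
  rw [lintegral_const_mul' _ _ (ENNReal.pow_ne_top enorm_ne_top), h, ← ofReal_norm, Complex.norm_real,
    Real.norm_of_nonneg (by positivity), ← mul_assoc, ← ENNReal.ofReal_pow (by positivity),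
    ← ENNReal.ofReal_mul (by positivity)]
  refine mul_le_mul' (le_of_eq ?_) (lintegral_fourier_sq_le a.integrable (a.memLp 2 volume))
  congr 1
  field_simp

/-- The integral kernel of left Moyal multiplication. -/
def moyalKernel (θ : ℝ) (a : 𝓢(Plane, ℂ)) (x w : Plane) : ℂ :=
  moyalSymbol θ a (-(x - w)) * Complex.exp (Complex.I * (2 * thetaForm θ x w : ℝ))

theorem isSchurKernel_moyalKernel (hθ : θ ≠ 0) (a : 𝓢(Plane, ℂ)) :
    IsSchurKernel volume (moyalKernel θ a) (∫⁻ v, ‖moyalSymbol θ a (-v)‖ₑ).toNNReal := by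
  refine isSchurKernel_conv (k := fun v => moyalSymbol θ a (-v))
    ((continuous_moyalSymbol θ a).comp continuous_neg).measurable ?_ ?_
  · rw [lintegral_neg_eq_self (fun v => ‖moyalSymbol θ a v‖ₑ)]
    exact lintegral_moyalSymbol_lt_top hθ a
  · exact (measurable_thetaForm θ).const_mul 2

theorem thetaForm_add_right (θ : ℝ) (x y z : Plane) :
    thetaForm θ x (y + z) = thetaForm θ x y + thetaForm θ x z := by
  simp only [thetaForm, PiLp.add_apply]
  ring

theorem continuous_thetaForm (θ : ℝ) : Continuous fun p : Plane × Plane => thetaForm θ p.1 p.2 := by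
  unfold thetaForm
  fun_prop

/-- Substitute `y = u - x`, `z = w - x`. In `(u - x)Θ⁻¹z` the term `uΘ⁻¹z` produces the symplectic
Fourier transform of `a`, and `xΘ⁻¹z = xΘ⁻¹w` is the outer phase. -/
theorem moyal_eq_integral (hθ : θ ≠ 0) (a f : 𝓢(Plane, ℂ)) (x : Plane) :
    moyal θ a f x = ∫ w, moyalKernel θ a x w * f w := by
  have hi : Integrable (fun p : Plane × Plane => a (x + p.1) * f (x + p.2) *
      Complex.exp (-2 * Complex.I * (thetaForm θ p.1 p.2 : ℝ))) := by
    have h1 : Integrable (fun p : Plane × Plane => a (x + p.1) * f (x + p.2)) :=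
      (a.integrable.comp_add_left x).mul_prod (f.integrable.comp_add_left x)
    refine h1.mul_bdd (c := 1) ?_ (ae_of_all _ fun p => ?_)
    · have := continuous_thetaForm θ
      exact Continuous.aestronglyMeasurable (by fun_prop)
    · rw [show -2 * Complex.I * ((thetaForm θ p.1 p.2 : ℝ) : ℂ) =
        Complex.I * ((-2 * thetaForm θ p.1 p.2 : ℝ) : ℂ) by push_cast; ring, norm_cexp_I_mul]
  rw [moyal, Measure.volume_eq_prod, integral_prod_symm _ hi, ← integral_const_mul]
  rw [← integral_add_left_eq_self (fun w => moyalKernel θ a x w * f w) x]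
  refine integral_congr_ae (ae_of_all _ fun z => ?_)
  simp only
  have h2 : ∫ y, a (x + y) * f (x + z) * Complex.exp (-2 * Complex.I * (thetaForm θ y z : ℝ)) =
      ∫ u, a u * f (x + z) * Complex.exp (-2 * Complex.I * (thetaForm θ (-x + u) z : ℝ)) := by
    rw [← integral_add_left_eq_self (fun u => a u * f (x + z) *
      Complex.exp (-2 * Complex.I * (thetaForm θ (-x + u) z : ℝ))) x]
    simp only [neg_add_cancel_left]
  rw [h2, moyalKernel, show -(x - (x + z)) = z by abel, moyalSymbol_eq hθ, mul_assoc, mul_assoc,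
    ← integral_mul_const]
  congr 1
  refine integral_congr_ae (ae_of_all _ fun u => ?_)
  have e : Complex.exp (-2 * Complex.I * (thetaForm θ (-x + u) z : ℝ)) =
      Complex.exp (Complex.I * (-(2 * thetaForm θ u z) : ℝ)) *
        Complex.exp (Complex.I * (2 * thetaForm θ x (x + z) : ℝ)) := by
    rw [← Complex.exp_add]
    congr 1
    have h3 : thetaForm θ (-x + u) z = thetaForm θ u z - thetaForm θ x z := by
      simp only [thetaForm, PiLp.add_apply, PiLp.neg_apply]
      ring
    rw [thetaForm_add_right, thetaForm_self, h3]
    push_cast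
    ring
  simp only [e]
  ring

/-- The operator of left Moyal multiplication by a Schwartz function. -/
def moyalLeft (hθ : θ ≠ 0) (a : 𝓢(Plane, ℂ)) : L2Plane →L[ℂ] L2Plane :=
  (isSchurKernel_moyalKernel hθ a).op

theorem isMoyalLeft_moyalLeft (hθ : θ ≠ 0) (a : 𝓢(Plane, ℂ)) :
    IsMoyalLeft θ a (moyalLeft hθ a) := by
  intro f
  filter_upwards [(isSchurKernel_moyalKernel hθ a).op_apply_ae (toL2 f)] with x hx
  rw [moyalLeft, hx, moyal_eq_integral hθ]
  refine integral_congr_ae ?_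
  filter_upwards [f.coeFn_toLp 2 volume] with y hy
  have hy' : (toL2 f : Plane → ℂ) y = f y := hy
  rw [hy']

end Moyal

/-! ### The kernel of the product and its Hilbert–Schmidt norm -/

section Kernel

open FourierTransform

variable {θ ξ : ℝ}

/-- The exponentials are unimodular, which leaves a product of the integrable functions `a` and `Φ`
in separate variables. -/
theorem integrable_kernelIntegrand (hθ : 0 < θ) (hξ : 0 < ξ) (μ : ℝ) (a : 𝓢(Plane, ℂ))
    (x y : Plane) : Integrable (kernelIntegrand θ ξ μ a x y) := by
  have h1 : Integrable (fun p : Plane × Plane => a p.1 * (Phi θ ξ μ p.2 : ℂ)) :=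
    a.integrable.mul_prod (integrable_Phi hθ hξ μ).ofReal
  have hn : ∀ r : ℝ, ‖Complex.exp (2 * Complex.I * (r : ℂ))‖ ≤ 1 := fun r => by
    rw [show 2 * Complex.I * (r : ℂ) = Complex.I * ((2 * r : ℝ) : ℂ) by push_cast; ring,
      norm_cexp_I_mul]
  have hc1 : Continuous fun p : Plane × Plane => thetaForm θ x (p.2 - p.1) := by
    unfold thetaForm
    fun_prop
  have hc2 : Continuous fun p : Plane × Plane => thetaForm θ y (p.1 + ξ • p.2) := by
    unfold thetaForm
    fun_prop
  have hc3 := continuous_thetaForm θ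
  refine ((h1.mul_bdd (c := 1) ?_ (ae_of_all _ fun p => hn _)).mul_bdd (c := 1) ?_
    (ae_of_all _ fun p => hn _)).mul_bdd (c := 1) ?_ (ae_of_all _ fun p => ?_)
  · exact Continuous.aestronglyMeasurable (by fun_prop)
  · exact Continuous.aestronglyMeasurable (by fun_prop)
  · exact Continuous.aestronglyMeasurable (by fun_prop)
  · have := hn (-thetaForm θ p.1 p.2)
    rwa [Complex.ofReal_neg, mul_neg, ← neg_mul, ← neg_mul] at this

/-- The substitution `w = y + v` and the integral formula for the symbol turn the composed kernel
into the stated double integral; antisymmetry of the form reconciles the phases. -/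
theorem kernel_eq_integral (hθ : 0 < θ) (hξ : 0 < ξ) (μ : ℝ) (a : 𝓢(Plane, ℂ)) (x y : Plane) :
    kernel θ ξ μ a x y = ∫ w, moyalKernel θ a x w * resKernel θ ξ μ w y := by
  rw [kernel, Measure.volume_eq_prod,
    integral_prod_symm _ (integrable_kernelIntegrand hθ hξ μ a x y), ← integral_const_mul,
    ← integral_add_left_eq_self (fun w => moyalKernel θ a x w * resKernel θ ξ μ w y) y]
  refine integral_congr_ae (ae_of_all _ fun v => ?_)
  simp only
  rw [moyalKernel, moyalSymbol_eq hθ.ne', resKernel, add_sub_cancel_left, ← integral_const_mul,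
    ← integral_const_mul, ← integral_mul_const, ← integral_mul_const]
  refine integral_congr_ae (ae_of_all _ fun u => ?_)
  have e : Complex.exp (2 * Complex.I * (thetaForm θ x y : ℝ)) *
      (Complex.exp (2 * Complex.I * (thetaForm θ x (v - u) : ℝ)) *
      Complex.exp (2 * Complex.I * (thetaForm θ y (u + ξ • v) : ℝ)) *
      Complex.exp (-2 * Complex.I * (thetaForm θ u v : ℝ))) =
      Complex.exp (Complex.I * (-(2 * thetaForm θ u (-(x - (y + v)))) : ℝ)) *
      Complex.exp (Complex.I * (2 * thetaForm θ x (y + v) : ℝ)) *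
      Complex.exp (Complex.I * (-(2 * ξ * thetaForm θ (y + v) y) : ℝ)) := by
    simp only [← Complex.exp_add]
    congr 1
    simp [thetaForm]
    ring
  simp only [kernelIntegrand]
  push_cast at e ⊢
  linear_combination (a u * (Phi θ ξ μ v : ℂ) / ((Real.pi : ℂ) * θ) ^ 2) * e

theorem hasIntegralKernel (hθ : 0 < θ) (hξ : 0 < ξ) (μ : ℝ) (a : 𝓢(Plane, ℂ)) :
    HasIntegralKernel (moyalLeft hθ.ne' a ∘L resolvent hθ hξ μ) (kernel θ ξ μ a) := by
  intro ψ
  simp only [kernel_eq_integral hθ hξ]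
  exact (isSchurKernel_moyalKernel hθ.ne' a).op_comp_op (isSchurKernel_resKernel hθ hξ μ) ψ

theorem measurable_kernel (hθ : 0 < θ) (hξ : 0 < ξ) (μ : ℝ) (a : 𝓢(Plane, ℂ)) :
    Measurable (Function.uncurry (kernel θ ξ μ a)) := by
  have h1 : Measurable fun q : (Plane × Plane) × Plane =>
      Function.uncurry (moyalKernel θ a) (q.1.1, q.2) :=
    (isSchurKernel_moyalKernel hθ.ne' a).measurable.comp
      (measurable_fst.fst.prodMk measurable_snd)
  have h2 : Measurable fun q : (Plane × Plane) × Plane =>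
      Function.uncurry (resKernel θ ξ μ) (q.2, q.1.2) :=
    (isSchurKernel_resKernel hθ hξ μ).measurable.comp
      (measurable_snd.prodMk measurable_fst.snd)
  have h3 := ((h1.mul h2).stronglyMeasurable.integral_prod_right' (ν := volume)).measurable
  have e : Function.uncurry (kernel θ ξ μ a) = fun p : Plane × Plane =>
      ∫ w, moyalKernel θ a p.1 w * resKernel θ ξ μ w p.2 :=
    funext fun p => kernel_eq_integral hθ hξ μ a p.1 p.2
  rw [e]
  exact h3

/-- The kernel as a Fourier transform. -/
theorem kernel_add_right (hθ : 0 < θ) (hξ : 0 < ξ) (μ : ℝ) (a : 𝓢(Plane, ℂ)) (x q : Plane) :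
    kernel θ ξ μ a x (x + q) = Complex.exp (Complex.I * (-(2 * ξ * thetaForm θ x q) : ℝ)) *
      𝓕 (fun p => moyalSymbol θ a p * (Phi θ ξ μ (p - q) : ℂ))
        ((Real.pi * θ)⁻¹ • quarterTurn ((1 + ξ) • x + ξ • q)) := by
  rw [kernel_eq_integral hθ hξ, fourier_smul_quarterTurn hθ.ne', ← integral_const_mul,
    ← integral_add_left_eq_self (fun w => moyalKernel θ a x w * resKernel θ ξ μ w (x + q)) x]
  refine integral_congr_ae (ae_of_all _ fun p => ?_)
  simp only
  rw [moyalKernel, resKernel, show -(x - (x + p)) = p by abel,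
    show x + p - (x + q) = p - q by abel]
  -- The pairing of `p` with `x` has weight `1` from the Moyal phase and `ξ` from the magnetic
  -- phase; their sum is the source of `1 + ξ`.
  have e : Complex.exp (Complex.I * (2 * thetaForm θ x (x + p) : ℝ)) *
      Complex.exp (Complex.I * (-(2 * ξ * thetaForm θ (x + p) (x + q)) : ℝ)) =
      Complex.exp (Complex.I * (-(2 * ξ * thetaForm θ x q) : ℝ)) *
      Complex.exp (Complex.I * (-(2 * thetaForm θ p ((1 + ξ) • x + ξ • q)) : ℝ)) := by
    simp only [← Complex.exp_add]
    congr 1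
    simp [thetaForm]
    ring
  linear_combination (moyalSymbol θ a p * (Phi θ ξ μ (p - q) : ℂ)) * e

/-- For fixed `q` the frequency is a rotation of `x` scaled by `(1 + ξ)/(πθ)`, up to translation.
Plancherel applies with the Jacobian `(πθ)²/(1 + ξ)²`. -/
theorem lintegral_kernel_add_right_sq_le (hθ : 0 < θ) (hξ : 0 < ξ) (μ : ℝ) (a : 𝓢(Plane, ℂ))
    (q : Plane) : ∫⁻ x, ‖kernel θ ξ μ a x (x + q)‖ₑ ^ 2 ≤
      ENNReal.ofReal ((Real.pi * θ) ^ 2 / (1 + ξ) ^ 2) *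
        ∫⁻ p, ‖moyalSymbol θ a p‖ₑ ^ 2 * ‖Phi θ ξ μ (p - q)‖ₑ ^ 2 := by
  set g : Plane → ℂ := fun p => moyalSymbol θ a p * (Phi θ ξ μ (p - q) : ℂ) with hg
  obtain ⟨C, hC⟩ := norm_moyalSymbol_le θ a
  have hΦ1 : Integrable fun p => (Phi θ ξ μ (p - q) : ℂ) :=
    ((integrable_Phi hθ hξ μ).ofReal (𝕜 := ℂ)).comp_sub_right q
  have hgi : Integrable g := hΦ1.bdd_mul (continuous_moyalSymbol θ a).aestronglyMeasurable
    (ae_of_all _ hC)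
  have hΦ2 : MemLp (fun p => (Phi θ ξ μ (p - q) : ℂ)) 2 := by
    refine ⟨hΦ1.aestronglyMeasurable, ?_⟩
    rw [eLpNorm_lt_top_iff_lintegral_rpow_enorm_lt_top two_ne_zero (by simp)]
    simp only [ENNReal.toReal_ofNat, ENNReal.rpow_two]
    rw [lintegral_sub_right_eq_self (fun p => ‖(Phi θ ξ μ p : ℂ)‖ₑ ^ 2) q]
    refine lt_of_le_of_lt (le_of_eq ?_) ((lintegral_Phi_sq_le hθ hξ μ).trans_lt
      ENNReal.ofReal_lt_top)
    simp only [← ofReal_norm, Complex.norm_real]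
  have hg2 : MemLp g 2 := by
    refine hΦ2.of_le_mul (c := C) hgi.aestronglyMeasurable (ae_of_all _ fun p => ?_)
    rw [hg, norm_mul]
    gcongr
    exact hC p
  have hm : Measurable fun w => ‖𝓕 g w‖ₑ ^ 2 :=
    (VectorFourier.fourierIntegral_continuous Real.continuous_fourierChar
      (L := innerₗ Plane) continuous_inner hgi).measurable.enorm.pow_const 2
  have hr : (Real.pi * θ)⁻¹ * (1 + ξ) ≠ 0 := by positivity
  calc ∫⁻ x, ‖kernel θ ξ μ a x (x + q)‖ₑ ^ 2
      = ∫⁻ x, ‖𝓕 g (((Real.pi * θ)⁻¹ * (1 + ξ)) • quarterTurn x +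
          ((Real.pi * θ)⁻¹ * ξ) • quarterTurn q)‖ₑ ^ 2 := by
        refine lintegral_congr fun x => ?_
        rw [kernel_add_right hθ hξ, enorm_mul, enorm_cexp_I_mul, one_mul, map_add, map_smul,
          map_smul, smul_add, smul_smul, smul_smul]
    _ = ENNReal.ofReal ((((Real.pi * θ)⁻¹ * (1 + ξ)) ^ 2)⁻¹) * ∫⁻ w, ‖𝓕 g w‖ₑ ^ 2 :=
        lintegral_comp_smul_quarterTurn hm hr _
    _ ≤ _ := by
        refine mul_le_mul' (le_of_eq ?_) ((lintegral_fourier_sq_le hgi hg2).trans (le_of_eq ?_))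
        · congr 1
          have : 0 < Real.pi * θ := by positivity
          field_simp
        · simp only [hg, enorm_mul, mul_pow]
          simp only [← ofReal_norm, Complex.norm_real]

/-- The plane of pairs is foliated by the translates `y = x + q`. After Plancherel on each, the `q`
integral sees only `Φ(p - q)`, so the norms of the symbol and of `Φ` decouple. -/
theorem lintegral_kernel_sq_le (hθ : 0 < θ) (hξ : 0 < ξ) (μ : ℝ) (a : 𝓢(Plane, ℂ)) :
    ∫⁻ x, ∫⁻ y, ‖kernel θ ξ μ a x y‖ₑ ^ 2 ≤
      ENNReal.ofReal (Real.pi * θ / (64 * ξ * (1 + ξ) ^ 2)) * ∫⁻ u, ‖a u‖ₑ ^ 2 := by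
  have hm : Measurable fun p : Plane × Plane => ‖kernel θ ξ μ a p.1 (p.1 + p.2)‖ₑ ^ 2 :=
    ((measurable_kernel hθ hξ μ a).comp (by fun_prop : Measurable fun p : Plane × Plane =>
      (p.1, p.1 + p.2))).enorm.pow_const 2
  have hm2 : Measurable fun p : Plane × Plane =>
      ‖moyalSymbol θ a p.2‖ₑ ^ 2 * ‖Phi θ ξ μ (p.2 - p.1)‖ₑ ^ 2 :=
    (((continuous_moyalSymbol θ a).measurable.comp measurable_snd).enorm.pow_const 2).mul
      (((measurable_Phi θ ξ μ).comp (by fun_prop : Measurable fun p : Plane × Plane =>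
        p.2 - p.1)).enorm.pow_const 2)
  calc ∫⁻ x, ∫⁻ y, ‖kernel θ ξ μ a x y‖ₑ ^ 2
      = ∫⁻ x, ∫⁻ q, ‖kernel θ ξ μ a x (x + q)‖ₑ ^ 2 := by
        refine lintegral_congr fun x => ?_
        exact (lintegral_add_left_eq_self (fun y => ‖kernel θ ξ μ a x y‖ₑ ^ 2) x).symm
    _ = ∫⁻ q, ∫⁻ x, ‖kernel θ ξ μ a x (x + q)‖ₑ ^ 2 :=
        lintegral_lintegral_swap (f := fun x q => ‖kernel θ ξ μ a x (x + q)‖ₑ ^ 2) hm.aemeasurable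
    _ ≤ ∫⁻ q, ENNReal.ofReal ((Real.pi * θ) ^ 2 / (1 + ξ) ^ 2) *
        ∫⁻ p, ‖moyalSymbol θ a p‖ₑ ^ 2 * ‖Phi θ ξ μ (p - q)‖ₑ ^ 2 :=
        lintegral_mono fun q => lintegral_kernel_add_right_sq_le hθ hξ μ a q
    _ = ENNReal.ofReal ((Real.pi * θ) ^ 2 / (1 + ξ) ^ 2) *
        ((∫⁻ p, ‖moyalSymbol θ a p‖ₑ ^ 2) * ∫⁻ v, ‖Phi θ ξ μ v‖ₑ ^ 2) := by
        rw [lintegral_const_mul' _ _ ENNReal.ofReal_ne_top,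
          lintegral_lintegral_swap (f := fun q p =>
            ‖moyalSymbol θ a p‖ₑ ^ 2 * ‖Phi θ ξ μ (p - q)‖ₑ ^ 2) hm2.aemeasurable,
          ← lintegral_mul_const _ ((continuous_moyalSymbol θ a).measurable.enorm.pow_const 2)]
        congr 1
        refine lintegral_congr fun p => ?_
        rw [lintegral_const_mul' _ _ (ENNReal.pow_ne_top enorm_ne_top),
          lintegral_sub_left_eq_self (fun v => ‖Phi θ ξ μ v‖ₑ ^ 2) p]
    _ ≤ ENNReal.ofReal ((Real.pi * θ) ^ 2 / (1 + ξ) ^ 2) *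
        ((ENNReal.ofReal (1 / (Real.pi * θ) ^ 2) * ∫⁻ u, ‖a u‖ₑ ^ 2) *
          ENNReal.ofReal (Real.pi * θ / (64 * ξ))) := by
        gcongr
        · exact lintegral_moyalSymbol_sq_le hθ a
        · exact lintegral_Phi_sq_le hθ hξ μ
    _ = _ := by
        rw [mul_right_comm, ← mul_assoc, ← ENNReal.ofReal_mul (by positivity),
          ← ENNReal.ofReal_mul (by positivity)]
        congr 2
        field_simp

theorem hilbertSchmidtNormLE_moyalLeft_resolvent (hθ : 0 < θ) (hξ : 0 < ξ) (μ : ℝ)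
    (a : 𝓢(Plane, ℂ)) : HilbertSchmidtNormLE (moyalLeft hθ.ne' a ∘L resolvent hθ hξ μ)
      (√(Real.pi * θ / (64 * ξ * (1 + ξ) ^ 2)) * ‖toL2 a‖) := by
  refine hilbertSchmidtNormLE_of_kernel (measurable_kernel hθ hξ μ a)
    (fun ψ => (hasIntegralKernel hθ hξ μ a ψ).mono fun x hx => hx.2) (by positivity) ?_
  refine (lintegral_kernel_sq_le hθ hξ μ a).trans (le_of_eq ?_)
  rw [mul_pow, Real.sq_sqrt (by positivity), ENNReal.ofReal_mul (by positivity),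
    ENNReal.ofReal_pow (norm_nonneg _), ofReal_norm, Lp_enorm_sq]
  congr 1
  refine lintegral_congr_ae ?_
  filter_upwards [a.coeFn_toLp 2 volume] with u hu
  have hu' : (toL2 a : Plane → ℂ) u = a u := hu
  rw [hu']

end Kernel

end LandauMoyal

end

theorem mainTheorem6 (θ ξ : ℝ) (hθ : 0 < θ) (hξ : 0 < ξ) :
    ∃ (L : 𝓢(LandauMoyal.Plane, ℂ) → (LandauMoyal.L2Plane →L[ℂ] LandauMoyal.L2Plane))
      (R : ℝ → (LandauMoyal.L2Plane →L[ℂ] LandauMoyal.L2Plane)),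
      -- `L a` is left Moyal multiplication by `a`, and `R μ` is the inverse of `H_L + μ²`
      (∀ a : 𝓢(LandauMoyal.Plane, ℂ), LandauMoyal.IsMoyalLeft θ a (L a)) ∧
      (∀ μ : ℝ, LandauMoyal.IsBoundedInverse
        (LandauMoyal.landauHamiltonian θ ξ) ((μ : ℂ) ^ 2) (R μ)) ∧
      -- the explicit kernel, with absolute convergence of the integrals that define it
      (∀ (μ : ℝ) (v : LandauMoyal.Plane), v ≠ 0 →
        IntegrableOn (LandauMoyal.phiIntegrand θ ξ μ v) (Ioi 0)) ∧
      (∀ (a : 𝓢(LandauMoyal.Plane, ℂ)) (μ : ℝ),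
        (∀ x y : LandauMoyal.Plane,
          Integrable (LandauMoyal.kernelIntegrand θ ξ μ a x y) volume) ∧
        LandauMoyal.HasIntegralKernel (L a ∘L R μ) (LandauMoyal.kernel θ ξ μ a)) ∧
      -- the Hilbert-Schmidt property with its bound, and compactness
      (ξ ≠ 1 → ∀ (a : 𝓢(LandauMoyal.Plane, ℂ)) (μ : ℝ),
        LandauMoyal.HilbertSchmidtNormLE (L a ∘L R μ)
          (√(Real.pi * θ / (64 * ξ * (1 + ξ) ^ 2)) * ‖LandauMoyal.toL2 a‖)) ∧
      (ξ ≠ 1 → ∀ (a : 𝓢(LandauMoyal.Plane, ℂ)) (μ : ℝ),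
        IsCompactOperator (L a ∘L R μ)) := by
  refine ⟨LandauMoyal.moyalLeft hθ.ne', LandauMoyal.resolvent hθ hξ,
    LandauMoyal.isMoyalLeft_moyalLeft hθ.ne', LandauMoyal.isBoundedInverse_resolvent hθ hξ,
    fun μ v hv => LandauMoyal.phiIntegrand_integrableOn hθ hξ μ hv, fun a μ =>
    ⟨LandauMoyal.integrable_kernelIntegrand hθ hξ μ a, LandauMoyal.hasIntegralKernel hθ hξ μ a⟩,
    fun _ a μ => LandauMoyal.hilbertSchmidtNormLE_moyalLeft_resolvent hθ hξ μ a, fun _ a μ =>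
    (LandauMoyal.hilbertSchmidtNormLE_moyalLeft_resolvent hθ hξ μ a).isCompactOperator⟩
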